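/- Let $q=2^f$ with $f\ge 1$, let $V$ be a $4$-dimensional vector space over $\mathbb F_q$ with a nondegenerate alternating bilinear form $B$, let $\mathrm{Sp}(V)\cong \mathrm{Sp}_4(q)$ be its isometry group, and let $G=\mathrm{Aut}(\mathrm{Sp}(V))$. Let $\Delta$ be the set of totally isotropic subspaces of $V$ of dimension $1$ (points) or $2$ (lines), and let $\Omega$ be the set of all unordered pairs $\{U,W\}$ with $U$ a totally isotropic point, $W$ a totally isotropic line and $U<W$. The group $G$ has a unique action on $\Delta$, written $X\mapsto X^g$, such that for all $g\in G$ and $X\in\Delta$ the stabiliser of $X^g$ in $\mathrm{Sp}(V)$ is the image under the automorphism $g$ of the stabiliser of $X$ in $\mathrm{Sp}(V)$; this action maps pairs in $\Omega$ to pairs in $\Omega$. For all $\{U_1,W_1\},\{U_2,W_2\}\in\Omega$ there exists $g\in G$ such that $\{U_1,W_1\}^g=\{U_2,W_2\}$ and $\{U_2,W_2\}^g=\{U_1,W_1\}$; that is, every orbital of $G$ on $\Omega$ is self-paired. Consequently, let $\Gamma$ be a digraph (never having both $u\to v$ and $v\to u$) with at least one arc, on which $G$ acts by automorphisms, transitively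 on the vertices. Then no vertex stabiliser $G_v$ equals the stabiliser $G_{\{U,W\}}$ of a pair $\{U,W\}\in\Omega$ (an $\mathcal A_1$-subgroup). In particular this holds for every $G$-vertex-primitive $(G,s)$-arc-transitive digraph of valency at least $3$ with $s\ge 2$. -/

import Mathlib

open scoped Pointwise

namespace SymplecticFlags

variable {K V : Type*} [Field K] [AddCommGroup V] [Module K V]

/-- The symplectic group `Sp(V)`: all linear automorphisms of `V` that preserve the form `B`. -/
def Sp (B : LinearMap.BilinForm K V) : Subgroup (V ≃ₗ[K] V) where
  carrier := {g | ∀ x y, B (g x) (g y) = B x y}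
  mul_mem' := by
    intro a b ha hb x y
    rw [LinearEquiv.mul_apply, LinearEquiv.mul_apply, ha, hb]
  one_mem' := by
    intro x y
    rfl
  inv_mem' := by
    intro a ha x y
    have h := ha (a⁻¹ x) (a⁻¹ y)
    rw [← LinearEquiv.mul_apply, ← LinearEquiv.mul_apply, mul_inv_cancel] at h
    exact h.symm

/-- A subspace is totally isotropic if the form vanishes identically on it. -/
def IsTotallyIsotropic (B : LinearMap.BilinForm K V) (X : Submodule K V) : Prop :=
  ∀ x ∈ X, ∀ y ∈ X, B x y = 0

/-- The set `Δ = Δ₁ ∪ Δ₂` of all totally isotropic points and lines, that is, of all totally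
isotropic subspaces of dimension `1` or `2`. -/
def PointLine (B : LinearMap.BilinForm K V) : Type _ :=
  {X : Submodule K V // IsTotallyIsotropic B X ∧
    (Module.finrank K X = 1 ∨ Module.finrank K X = 2)}

/-- The set `Ω` of all unordered pairs `{U, W}`, where `U` is a totally isotropic point, `W` is a
totally isotropic line and `U < W`. -/
def flags (B : LinearMap.BilinForm K V) : Set (Set (PointLine B)) :=
  {ω | ∃ U W : PointLine B, Module.finrank K U.1 = 1 ∧ Module.finrank K W.1 = 2 ∧
    U.1 < W.1 ∧ ω = {U, W}}

/-- The stabiliser in `Sp(V)` of a subspace `X`. -/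
def stab (B : LinearMap.BilinForm K V) (X : Submodule K V) : Subgroup (Sp B) where
  carrier := {g | X.map (g.1 : V →ₗ[K] V) = X}
  mul_mem' := by
    intro a b ha hb
    change X.map ((a.1 : V →ₗ[K] V) ∘ₗ (b.1 : V →ₗ[K] V)) = X
    rw [Submodule.map_comp, hb, ha]
  one_mem' := Submodule.map_id X
  inv_mem' := by
    intro a ha
    change X.map ((a⁻¹).1 : V →ₗ[K] V) = X
    have ha' : X.map (a.1 : V →ₗ[K] V) = X := ha
    have h : X.map (((a⁻¹).1 : V →ₗ[K] V) ∘ₗ (a.1 : V →ₗ[K] V)) = X := by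
      have h1 : ((a⁻¹).1 : V →ₗ[K] V) ∘ₗ (a.1 : V →ₗ[K] V) = LinearMap.id := by
        ext x
        exact a.1.symm_apply_apply x
      rw [h1, Submodule.map_id]
    rwa [Submodule.map_comp, ha'] at h

/-- `ρ` is the action of `Aut(Sp(V))` on the totally isotropic points and lines that is induced by
its action on the stabilisers of these subspaces: the automorphism `φ` sends `X` to the subspace
whose stabiliser is the image under `φ` of the stabiliser of `X`. On inner automorphisms this is
the usual action of `Sp(V)` on subspaces. -/
def IsInducedAction (B : LinearMap.BilinForm K V)
    (ρ : MulAut (Sp B) →* Equiv.Perm (PointLine B)) : Prop :=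
  ∀ (φ : MulAut (Sp B)) (X : PointLine B),
    stab B (ρ φ X).1 = (stab B X.1).map φ.toMonoidHom

/-- The stabiliser in `Aut(Sp(V))` of a set `ω` of totally isotropic points and lines, under the
action `ρ`. For `ω = {U, W}` in `flags B` these are the `𝒜₁`-subgroups. -/
def setStabiliser (B : LinearMap.BilinForm K V)
    (ρ : MulAut (Sp B) →* Equiv.Perm (PointLine B)) (ω : Set (PointLine B)) :
    Subgroup (MulAut (Sp B)) :=
  (MulAction.stabilizer (Equiv.Perm (PointLine B)) ω).comap ρ

end SymplecticFlags

/-! The totally isotropic points and lines form the generalized quadrangle of `Sp(V)`, whose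
apartments are octagons in the incidence graph; the elements of `Ω` are the edges of this graph. Any
two edges lie in a common octagon (`exists_common_apartment`). In characteristic `2` the quadrangle
is self-dual, and `Aut(Sp(V))` induces on each octagon the full dihedral group of order `16`: a
duality built from Plücker coordinates rotates it by one step (`IsCyclicBasis.dualAut_apartment`),
and an isometry reflects it (`IsCyclicBasis.exists_neg_apartment`). Some reflection of the octagon
interchanges any two given edges, which is the self-pairedness.

For this, automorphisms of the abstract group must act on the geometry. Every `X` in `Δ` is the
centre of a root element commuting with an element of order `3`, and conversely every involution
commuting with an element of order `3` is a root element (`exists_isRootElement`). The stabiliser of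
the centre is the normaliser of the centraliser of the root element (`IsRootElement.mem_stab_iff`),
so automorphisms permute these stabilisers. Incidence is also visible in the group: for `X` and `Y`
of different dimensions, a root element with centre `X` stabilises `Y` only if they are incident.

If a vertex stabiliser were the stabiliser of `ω ∈ Ω`, the vertices would correspond equivariantly
to the orbit of `ω`; swapping the two ends of an arc would then reverse it
(`stabilizer_ne_of_swap`). -/

namespace SymplecticFlags

variable {K V : Type*} [Field K] [AddCommGroup V] [Module K V]
  {B : LinearMap.BilinForm K V}

/-! ### Linear algebra of the form, transvections, and stabilisers. -/

section Basic

theorem add_self_char_two [CharP K 2] (x : V) : x + x = 0 := by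
  rw [← two_smul K x, CharTwo.two_eq_zero, zero_smul]

theorem alt_comm [CharP K 2] (hB : B.IsAlt) (x y : V) : B x y = B y x := by
  rw [← hB.neg_eq y x, CharTwo.neg_eq]

theorem mem_perp_span_singleton {v x : V} :
    x ∈ B.orthogonal (Submodule.span K {v}) ↔ B v x = 0 := by
  rw [LinearMap.BilinForm.mem_orthogonal_iff]
  constructor
  · intro h
    exact h v (Submodule.mem_span_singleton_self v)
  · intro h n hn
    obtain ⟨c, rfl⟩ := Submodule.mem_span_singleton.1 hn
    simp [h]

theorem mem_perp_span_pair {a b x : V} :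
    x ∈ B.orthogonal (Submodule.span K {a, b}) ↔ B a x = 0 ∧ B b x = 0 := by
  rw [LinearMap.BilinForm.mem_orthogonal_iff]
  constructor
  · intro h
    exact ⟨h a (Submodule.subset_span (by simp)), h b (Submodule.subset_span (by simp))⟩
  · rintro ⟨h, h'⟩ n hn
    obtain ⟨c, d, rfl⟩ := Submodule.mem_span_pair.1 hn
    simp [h, h']

/-- Nondegeneracy lets one prescribe the values of the form against an independent family. -/
theorem exists_form_eq [FiniteDimensional K V] (hnd : B.Nondegenerate) {ι : Type*} {v : ι → V}
    (hv : LinearIndependent K v) (c : ι → K) : ∃ w, ∀ i, B w (v i) = c i := by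
  obtain ⟨f, hf⟩ := LinearMap.exists_extend ((Module.Basis.span hv).constr K c)
  refine ⟨(B.toDual hnd).symm f, fun i => ?_⟩
  rw [LinearMap.BilinForm.apply_toDual_symm_apply]
  have := LinearMap.congr_fun hf (Module.Basis.span hv i)
  rw [Module.Basis.constr_basis] at this
  rw [← this]
  simp [Module.Basis.span_apply]

theorem finrank_span_pair_eq {a b : V} (h : LinearIndependent K ![a, b]) :
    Module.finrank K (Submodule.span K {a, b}) = 2 := by
  have := finrank_span_eq_card h
  rwa [Matrix.range_cons, Matrix.range_cons, Matrix.range_empty, Set.union_empty] at this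

theorem exists_pair_of_finrank_eq_two {X : Submodule K V} (h : Module.finrank K X = 2) :
    ∃ a b, LinearIndependent K ![a, b] ∧ X = Submodule.span K {a, b} := by
  have : FiniteDimensional K X := Module.finite_of_finrank_eq_succ h
  let e := Module.finBasisOfFinrankEq K X h
  have hli : LinearIndependent K ![(e 0 : V), (e 1 : V)] := by
    have := e.linearIndependent.map' X.subtype X.ker_subtype
    have h2 : X.subtype ∘ e = ![(e 0 : V), (e 1 : V)] := by
      ext i; fin_cases i <;> rfl
    rwa [h2] at this
  refine ⟨e 0, e 1, hli, (Submodule.eq_of_le_of_finrank_eq ?_ ?_).symm⟩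
  · rw [Submodule.span_le]; rintro x (rfl | rfl) <;> simp
  · rw [finrank_span_pair_eq hli, h]

theorem exists_of_finrank_eq_one {X : Submodule K V} (h : Module.finrank K X = 1) :
    ∃ v, v ≠ 0 ∧ X = Submodule.span K {v} := by
  obtain ⟨v, hv, hs⟩ := finrank_eq_one_iff'.1 h
  refine ⟨v, by simpa using hv, le_antisymm (fun x hx => ?_) ?_⟩
  · obtain ⟨c, hc⟩ := hs ⟨x, hx⟩
    exact Submodule.mem_span_singleton.2 ⟨c, congrArg Subtype.val hc⟩
  · rw [Submodule.span_singleton_le_iff_mem]; exact v.2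

theorem isTotallyIsotropic_span_singleton (hB : B.IsAlt) (v : V) :
    IsTotallyIsotropic B (Submodule.span K {v}) := by
  intro x hx y hy
  obtain ⟨c, rfl⟩ := Submodule.mem_span_singleton.1 hx
  obtain ⟨d, rfl⟩ := Submodule.mem_span_singleton.1 hy
  simp [hB.self_eq_zero]

theorem isTotallyIsotropic_span_pair [CharP K 2] (hB : B.IsAlt) {a b : V} (hab : B a b = 0) :
    IsTotallyIsotropic B (Submodule.span K {a, b}) := by
  intro x hx y hy
  obtain ⟨c, d, rfl⟩ := Submodule.mem_span_pair.1 hx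
  obtain ⟨c', d', rfl⟩ := Submodule.mem_span_pair.1 hy
  have hba : B b a = 0 := by rw [alt_comm hB, hab]
  simp [hB.self_eq_zero, hab, hba]

theorem exists_perp_not_perp [FiniteDimensional K V] (hB : B.IsAlt) (hnd : B.Nondegenerate)
    {X : Submodule K V} {u : V} (hu : u ∉ X) : ∃ w ∈ B.orthogonal X, B w u ≠ 0 := by
  by_contra! h
  rw [← LinearMap.BilinForm.orthogonal_orthogonal hnd hB.isRefl X] at hu
  exact hu (LinearMap.BilinForm.mem_orthogonal_iff.2 h)

theorem mem_stab {X : Submodule K V} {g : Sp B} (h : ∀ x ∈ X, g.1 x ∈ X)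
    [FiniteDimensional K V] : g ∈ stab B X := by
  change X.map (g.1 : V →ₗ[K] V) = X
  refine Submodule.eq_of_le_of_finrank_eq ?_ ?_
  · rintro _ ⟨x, hx, rfl⟩; exact h x hx
  · exact LinearEquiv.finrank_map_eq g.1 X

theorem apply_mem_of_mem_stab {X : Submodule K V} {g : Sp B} (h : g ∈ stab B X) {x : V}
    (hx : x ∈ X) : g.1 x ∈ X := by
  have h' : X.map (g.1 : V →ₗ[K] V) = X := h
  rw [← h']; exact ⟨x, hx, rfl⟩

theorem apply_inv_apply (g : Sp B) (x : V) : g.1 ((g⁻¹).1 x) = x :=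
  g.1.apply_symm_apply x

theorem inv_apply_apply (g : Sp B) (x : V) : (g⁻¹).1 (g.1 x) = x :=
  g.1.symm_apply_apply x

theorem Sp_ext {g h : Sp B} (H : ∀ x, g.1 x = h.1 x) : g = h :=
  Subtype.ext (LinearEquiv.ext H)

theorem form_apply_left (g : Sp B) (x y : V) : B (g.1 x) y = B x ((g⁻¹).1 y) := by
  conv_lhs => rw [← apply_inv_apply g y]
  exact g.2 _ _

theorem form_apply_right (g : Sp B) (x y : V) : B x (g.1 y) = B ((g⁻¹).1 x) y := by
  conv_lhs => rw [← apply_inv_apply g x]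
  exact g.2 _ _

/-- The isometry `1 + N`, for a square-zero map `N` that is self-adjoint for the form. -/
def oneAdd [CharP K 2] (N : V →ₗ[K] V) (hN : ∀ x, N (N x) = 0)
    (hs : ∀ x y, B (N x) y = B x (N y)) :
    Sp B :=
  ⟨LinearEquiv.ofInvolutive (LinearMap.id + N) (fun x => by
    simp only [LinearMap.add_apply, LinearMap.id_apply, map_add, hN, add_zero]
    rw [add_assoc, add_self_char_two (K := K), add_zero]), fun x y => by
    change B (x + N x) (y + N y) = B x y
    have h : B (N x) (N y) = 0 := by rw [hs, hN, map_zero]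
    simp only [map_add, LinearMap.add_apply, h, hs, add_zero]
    rw [add_assoc, CharTwo.add_self_eq_zero, add_zero]⟩

theorem oneAdd_apply [CharP K 2] (N : V →ₗ[K] V) (hN : ∀ x, N (N x) = 0)
    (hs : ∀ x y, B (N x) y = B x (N y)) (x : V) : (oneAdd N hN hs).1 x = x + N x := rfl

theorem exists_transvection [CharP K 2] (hB : B.IsAlt) (v : V) (c : K) :
    ∃ t : Sp B, ∀ x, t.1 x = x + (c * B x v) • v := by
  refine ⟨oneAdd ((c • B.flip v).smulRight v) (fun x => ?_) (fun x y => ?_), fun x => ?_⟩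
  · simp [hB.self_eq_zero]
  · simp only [LinearMap.smulRight_apply, LinearMap.smul_apply, LinearMap.BilinForm.flip_apply, map_smul,
      smul_eq_mul, alt_comm hB v y]
    ring
  · rw [oneAdd_apply]; simp

theorem exists_double_transvection [CharP K 2] (hB : B.IsAlt) {a b : V} (hab : B a b = 0) :
    ∃ t : Sp B, ∀ x, t.1 x = x + (B x a • b + B x b • a) := by
  have hba : B b a = 0 := by rw [alt_comm hB, hab]
  refine ⟨oneAdd ((B.flip a).smulRight b + (B.flip b).smulRight a) (fun x => ?_) (fun x y => ?_),
    fun x => ?_⟩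
  · simp [hB.self_eq_zero, hab, hba]
  · simp only [LinearMap.smulRight_apply, LinearMap.add_apply, LinearMap.BilinForm.flip_apply, map_smul,
      smul_eq_mul, map_add, LinearMap.smul_apply, alt_comm hB a y, alt_comm hB b y]
    ring
  · rw [oneAdd_apply]; simp

/-- The transvections centred in `X^⊥` stabilise `X`. If `u ∈ Y` is outside `X`, one of them, with
centre `w`, moves `u`. As it also stabilises `Y`, it puts `w` into `Y`, although `B w u ≠ 0` and `Y`
is isotropic. -/
theorem stab_le_stab [CharP K 2] [FiniteDimensional K V] (hB : B.IsAlt) (hnd : B.Nondegenerate)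
    {X Y : Submodule K V} (hY : IsTotallyIsotropic B Y) (h : stab B X ≤ stab B Y) : Y ≤ X := by
  intro u hu
  by_contra hux
  obtain ⟨w, hw, hwu⟩ := exists_perp_not_perp hB hnd hux
  rw [LinearMap.BilinForm.mem_orthogonal_iff] at hw
  obtain ⟨t, ht⟩ := exists_transvection hB w 1
  have htX : t ∈ stab B X := mem_stab fun x hx => by simpa [ht, hw x hx] using hx
  have hm := apply_mem_of_mem_stab (h htX) hu
  rw [ht, Submodule.add_mem_iff_right _ hu] at hm
  rw [Submodule.smul_mem_iff _ (by rw [one_mul, alt_comm hB]; exact hwu)] at hm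
  exact hwu (hY w hm u hu)

theorem stab_injective [CharP K 2] [FiniteDimensional K V] (hB : B.IsAlt) (hnd : B.Nondegenerate)
    {X Y : PointLine B} (h : stab B X.1 = stab B Y.1) : X = Y :=
  Subtype.ext (le_antisymm (stab_le_stab hB hnd X.2.1 h.ge) (stab_le_stab hB hnd Y.2.1 h.le))

end Basic

/-! ### Root elements, and the stabiliser of the centre in group-theoretic terms. -/

section RootElements

/-- `t` is a long root element (a transvection with centre the point `X`) or a short root element
(an involution `1 + N` with `N` of image the totally isotropic line `X` and `B x (N x) = 0`). -/
def IsRootElement (t : Sp B) (X : Submodule K V) : Prop :=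
  (∃ v c, v ≠ 0 ∧ c ≠ 0 ∧ X = Submodule.span K {v} ∧ ∀ x, t.1 x = x + (c * B x v) • v) ∨
  (∃ a b, LinearIndependent K ![a, b] ∧ B a b = 0 ∧ X = Submodule.span K {a, b} ∧
    ∀ x, t.1 x = x + (B x a • b + B x b • a))

/-- `g` normalises the centraliser of `t`. -/
def NormalizesCentralizer {G : Type*} [Group G] (t g : G) : Prop :=
  ∀ h, h * t = t * h ↔ (g * h * g⁻¹) * t = t * (g * h * g⁻¹)

theorem normalizesCentralizer_map {G : Type*} [Group G] (φ : MulAut G) (t g : G) :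
    NormalizesCentralizer (φ t) (φ g) ↔ NormalizesCentralizer t g := by
  constructor
  · intro H h
    have := H (φ h)
    simpa only [← map_inv, ← map_mul, φ.injective.eq_iff] using this
  · intro H h
    obtain ⟨h, rfl⟩ := φ.surjective h
    simpa only [← map_inv, ← map_mul, φ.injective.eq_iff] using H h

theorem IsRootElement.apply_sub_mem {t : Sp B} {X : Submodule K V}
    (ht : IsRootElement t X) (x : V) : t.1 x - x ∈ X := by
  rcases ht with ⟨v, c, hv, hc, rfl, h⟩ | ⟨a, b, hab, -, rfl, h⟩
  · rw [h, add_sub_cancel_left]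
    exact Submodule.smul_mem _ _ (Submodule.mem_span_singleton_self v)
  · rw [h, add_sub_cancel_left]
    exact Submodule.mem_span_pair.2 ⟨_, _, add_comm _ _⟩

variable [CharP K 2] {t : Sp B} {X : Submodule K V}

theorem IsRootElement.pointLine (hB : B.IsAlt) (ht : IsRootElement t X) :
    IsTotallyIsotropic B X ∧ (Module.finrank K X = 1 ∨ Module.finrank K X = 2) := by
  rcases ht with ⟨v, c, hv, -, rfl, -⟩ | ⟨a, b, hab, h, rfl, -⟩
  · exact ⟨isTotallyIsotropic_span_singleton hB v, Or.inl (finrank_span_singleton hv)⟩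
  · exact ⟨isTotallyIsotropic_span_pair hB h, Or.inr (finrank_span_pair_eq hab)⟩

theorem IsRootElement.apply_eq_self_iff (hB : B.IsAlt) (ht : IsRootElement t X) (x : V) :
    t.1 x = x ↔ x ∈ B.orthogonal X := by
  rcases ht with ⟨v, c, hv, hc, rfl, h⟩ | ⟨a, b, hab, -, rfl, h⟩
  · rw [mem_perp_span_singleton, h, add_eq_left, smul_eq_zero, mul_eq_zero, alt_comm hB x]
    tauto
  · rw [mem_perp_span_pair, h, add_eq_left, alt_comm hB a, alt_comm hB b]
    constructor
    · intro h0
      rw [add_comm] at h0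
      have := LinearIndependent.pair_iff.1 hab _ _ h0
      exact this.symm
    · rintro ⟨h1, h2⟩
      simp [h1, h2]

theorem IsRootElement.mul_self (hB : B.IsAlt) (ht : IsRootElement t X) : t * t = 1 := by
  refine Sp_ext fun x => ?_
  change t.1 (t.1 x) = x
  have h : t.1 (t.1 x - x) = t.1 x - x := by
    rw [ht.apply_eq_self_iff hB, LinearMap.BilinForm.mem_orthogonal_iff]
    exact fun n hn => (ht.pointLine hB).1 n hn _ (ht.apply_sub_mem x)
  rw [map_sub] at h
  have h2 := add_self_char_two (K := K) (t.1 x - x)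
  rw [← sub_eq_zero]
  calc t.1 (t.1 x) - x = (t.1 (t.1 x) - t.1 x) + (t.1 x - x) := by abel
    _ = 0 := by rw [h, h2]

theorem IsRootElement.ne_one (hB : B.IsAlt) (hnd : B.Nondegenerate) (ht : IsRootElement t X) :
    t ≠ 1 := by
  rintro rfl
  have hX : ∀ x, x ∈ B.orthogonal X := fun x => (ht.apply_eq_self_iff hB x).1 rfl
  have h0 : ∀ x ∈ X, x = 0 := fun x hx =>
    hnd.1 x fun y => LinearMap.BilinForm.mem_orthogonal_iff.1 (hX y) x hx
  have hbot : X = ⊥ := (Submodule.eq_bot_iff X).2 h0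
  have := (ht.pointLine hB).2
  subst hbot
  simp at this

/-- Conjugation multiplies `t - 1` by a scalar: the square of the eigenvalue of `g⁻¹` on a point,
its determinant on a line. Hence whatever commutes with `t` commutes with the conjugate. -/
theorem IsRootElement.exists_conj_apply (ht : IsRootElement t X) {g : Sp B} (hg : g ∈ stab B X) :
    ∃ μ : K, ∀ y, (g⁻¹ * t * g).1 y = y + μ • (t.1 y - y) := by
  have key : ∀ y, (g⁻¹ * t * g).1 y = (g⁻¹).1 (t.1 (g.1 y)) := fun y => rfl
  have hg' := inv_mem hg
  rcases ht with ⟨v, c, hv, hc, rfl, h⟩ | ⟨a, b, hab, -, rfl, h⟩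
  · obtain ⟨l, hl⟩ := Submodule.mem_span_singleton.1
      (apply_mem_of_mem_stab hg' (Submodule.mem_span_singleton_self v))
    refine ⟨l ^ 2, fun y => ?_⟩
    rw [key, h, map_add, inv_apply_apply, map_smul, form_apply_left, ← hl, h, map_smul,
      smul_eq_mul]
    module
  · obtain ⟨p, q, hpq⟩ := Submodule.mem_span_pair.1
      (apply_mem_of_mem_stab hg' (x := a) (Submodule.subset_span (by simp)))
    obtain ⟨r, s, hrs⟩ := Submodule.mem_span_pair.1
      (apply_mem_of_mem_stab hg' (x := b) (Submodule.subset_span (by simp)))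
    refine ⟨p * s + q * r, fun y => ?_⟩
    rw [key, h, map_add, map_add, inv_apply_apply, map_smul, map_smul, form_apply_left,
      form_apply_left, ← hpq, ← hrs, h, map_add, map_add, map_smul, map_smul, map_smul, map_smul]
    simp only [smul_eq_mul]
    have h2 := CharTwo.two_eq_zero (R := K)
    have e1 := congrArg (fun k => (k * p * r * B y a) • a) h2
    have e2 := congrArg (fun k => (k * q * s * B y b) • b) h2
    simp only [zero_mul, zero_smul] at e1 e2
    rw [← sub_eq_zero]
    linear_combination (norm := module) e1 + e2

/-- An element commuting with `t` preserves its fixed space, which is `X^⊥`, and therefore `X^⊥⊥ =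
X`. -/
theorem IsRootElement.mem_stab_of_commute [FiniteDimensional K V] (hB : B.IsAlt)
    (hnd : B.Nondegenerate) (ht : IsRootElement t X) {h : Sp B} (hc : h * t = t * h) :
    h ∈ stab B X := by
  refine mem_stab fun x hx => ?_
  by_contra hx'
  obtain ⟨z, hz, hzx⟩ := exists_perp_not_perp hB hnd hx'
  rw [form_apply_right, alt_comm hB] at hzx
  refine hzx (LinearMap.BilinForm.mem_orthogonal_iff.1 ?_ x hx)
  rw [← ht.apply_eq_self_iff hB] at hz ⊢
  have hc' : t * h⁻¹ = h⁻¹ * t := by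
    rw [eq_inv_mul_iff_mul_eq, ← mul_assoc, hc, mul_inv_cancel_right]
  have := congrArg (fun k : Sp B => k.1 z) hc'
  change t.1 ((h⁻¹).1 z) = (h⁻¹).1 (t.1 z) at this
  rw [this, hz]

/-- The right-hand side mentions only the group structure, so every automorphism transports it. -/
theorem IsRootElement.mem_stab_iff [FiniteDimensional K V] (hB : B.IsAlt) (hnd : B.Nondegenerate)
    (ht : IsRootElement t X) (g : Sp B) : g ∈ stab B X ↔ NormalizesCentralizer t g := by
  have key : ∀ {k h : Sp B}, k ∈ stab B X → h * t = t * h →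
      h * (k⁻¹ * t * k) = (k⁻¹ * t * k) * h := by
    intro k h hk hh
    obtain ⟨μ, hμ⟩ := ht.exists_conj_apply hk
    refine Sp_ext fun y => ?_
    change h.1 ((k⁻¹ * t * k).1 y) = (k⁻¹ * t * k).1 (h.1 y)
    have hy : h.1 (t.1 y) = t.1 (h.1 y) := congrArg (fun z : Sp B => z.1 y) hh
    rw [hμ, hμ, map_add, map_smul, map_sub, hy]
  constructor
  · intro hg h
    constructor
    · intro hh
      have := key hg hh
      calc g * h * g⁻¹ * t = g * (h * (g⁻¹ * t * g)) * g⁻¹ := by group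
        _ = t * (g * h * g⁻¹) := by rw [this]; group
    · intro hh
      have := key (inv_mem hg) hh
      calc h * t = g⁻¹ * ((g * h * g⁻¹) * (g⁻¹⁻¹ * t * g⁻¹)) * g := by group
        _ = t * h := by rw [this]; group
  · intro H
    refine mem_stab fun u hu => ?_
    by_contra hux
    -- Here `u ∈ X` but `g u ∉ X`. The transvection `s` centred at `w ∈ X^⊥` commutes with `t`, so
    -- `g⁻¹ s g` does too and stabilises `X`. Applied to `u`, it forces `g⁻¹ w ∈ X`, whence `B (g u)
    -- w = 0`.
    obtain ⟨w, hw, hwu⟩ := exists_perp_not_perp hB hnd hux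
    obtain ⟨s, hs⟩ := exists_transvection hB w 1
    have htw := (ht.apply_eq_self_iff hB w).2 hw
    have htw' : (t⁻¹).1 w = w := by
      conv_lhs => rw [← htw]
      exact inv_apply_apply t w
    have hst : s * t = t * s := by
      refine Sp_ext fun y => ?_
      change s.1 (t.1 y) = t.1 (s.1 y)
      rw [hs, hs, map_add, map_smul, htw, form_apply_left, htw']
    have hc : (g⁻¹ * s * g) * t = t * (g⁻¹ * s * g) := by
      refine (H _).2 ?_
      have : g * (g⁻¹ * s * g) * g⁻¹ = s := by group
      rw [this, hst]
    have hstab := ht.mem_stab_of_commute hB hnd hc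
    have hm := apply_mem_of_mem_stab hstab hu
    have e : (g⁻¹ * s * g).1 u = u + B (g.1 u) w • (g⁻¹).1 w := by
      change (g⁻¹).1 (s.1 (g.1 u)) = _
      rw [hs, map_add, inv_apply_apply, one_mul, map_smul]
    rw [e, Submodule.add_mem_iff_right _ hu,
      Submodule.smul_mem_iff _ (by rw [alt_comm hB]; exact hwu)] at hm
    have := (ht.pointLine hB).1 _ hm _ hu
    rw [form_apply_left, inv_inv] at this
    exact hwu this

end RootElements

/-! ### Involutions centralised by an element of order 3. -/

section Involutions

theorem IsTotallyIsotropic.le_orthogonal {X : Submodule K V} (hX : IsTotallyIsotropic B X) :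
    X ≤ B.orthogonal X := fun x hx =>
  LinearMap.BilinForm.mem_orthogonal_iff.2 fun y hy => hX y hy x hx

theorem IsTotallyIsotropic.orthogonal_eq [FiniteDimensional K V] (hV : Module.finrank K V = 4)
    (hnd : B.Nondegenerate) {X : Submodule K V} (hX : IsTotallyIsotropic B X)
    (h2 : Module.finrank K X = 2) : B.orthogonal X = X := by
  refine (Submodule.eq_of_le_of_finrank_eq hX.le_orthogonal ?_).symm
  rw [LinearMap.BilinForm.finrank_orthogonal hnd, hV, h2]

theorem IsTotallyIsotropic.finrank_le_two [FiniteDimensional K V] (hV : Module.finrank K V = 4)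
    (hnd : B.Nondegenerate) {X : Submodule K V} (hX : IsTotallyIsotropic B X) :
    Module.finrank K X ≤ 2 := by
  have h := Submodule.finrank_mono hX.le_orthogonal
  rw [LinearMap.BilinForm.finrank_orthogonal hnd, hV] at h
  omega

variable [CharP K 2]

/-- An isometry of order dividing `3` that acts trivially on a totally isotropic line is trivial. -/
theorem eq_one_of_trivial_on_line [FiniteDimensional K V] (hV : Module.finrank K V = 4)
    (hnd : B.Nondegenerate) {X : Submodule K V} (hX : IsTotallyIsotropic B X)
    (h2 : Module.finrank K X = 2) {g : Sp B} (hg3 : ∀ x, g.1 (g.1 (g.1 x)) = x)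
    (hgX : ∀ x ∈ X, g.1 (g.1 x) = x) : g = 1 := by
  have hgX' : ∀ x ∈ X, g.1 x = x := fun x hx => by
    have := hg3 x
    rwa [hgX x hx] at this
  refine Sp_ext fun x => ?_
  change g.1 x = x
  -- `g - 1` kills `X` and maps `V` into `X^⊥ = X`, so `(g - 1)² = 0`. In characteristic `2` this
  -- says `g² = 1`, and `g³ = 1` finishes.
  have hmem : g.1 x - x ∈ X := by
    rw [← hX.orthogonal_eq hV hnd h2, LinearMap.BilinForm.mem_orthogonal_iff]
    intro n hn
    rw [map_sub, sub_eq_zero]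
    conv_lhs => rw [← hgX' n hn]
    exact g.2 n x
  have h := hgX' _ hmem
  rw [map_sub] at h
  have h4 : g.1 (g.1 x) = x := by
    have h5 := add_self_char_two (K := K) (g.1 x)
    have h6 := add_self_char_two (K := K) x
    rw [sub_eq_iff_eq_add] at h
    rw [h, sub_add_eq_add_sub, h5, zero_sub]
    exact neg_eq_of_add_eq_zero_left h6
  have := hg3 x
  rwa [h4] at this

/-- An involution commuting with an element of order `3` is a root element. -/
theorem exists_isRootElement [Finite K] [FiniteDimensional K V] (hV : Module.finrank K V = 4)
    (hB : B.IsAlt) (hnd : B.Nondegenerate) {t g : Sp B} (h1 : t ≠ 1) (h2 : t * t = 1) (hg1 : g ≠ 1)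
    (hg3 : g * g * g = 1) (hgt : g * t = t * g) : ∃ X, IsRootElement t X := by
  set N : V →ₗ[K] V := (t.1 : V →ₗ[K] V) - LinearMap.id with hN
  have hNx : ∀ x, N x = t.1 x - x := fun x => rfl
  have htx : ∀ x, t.1 x = x + N x := fun x => by rw [hNx]; abel
  have htt : ∀ x, t.1 (t.1 x) = x := fun x => congrArg (fun k : Sp B => k.1 x) h2
  have hinv : t⁻¹ = t := inv_eq_of_mul_eq_one_right h2
  have hself : ∀ x y, B (N x) y = B x (N y) := fun x y => by
    rw [hNx, hNx, map_sub, map_sub, LinearMap.sub_apply, form_apply_left, hinv]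
  have hNN : ∀ x, N (N x) = 0 := fun x => by
    rw [hNx (N x), hNx x, map_sub, htt, ← neg_sub (t.1 x) x, ← neg_add',
      add_self_char_two (K := K), neg_zero]
  have hgN : ∀ x, g.1 (N x) = N (g.1 x) := fun x => by
    have : g.1 (t.1 x) = t.1 (g.1 x) := congrArg (fun k : Sp B => k.1 x) hgt
    rw [hNx, hNx, map_sub, this]
  have hgg : ∀ x, g.1 (g.1 (g.1 x)) = x := fun x => congrArg (fun k : Sp B => k.1 x) hg3
  have hNne : ∃ x, N x ≠ 0 := by
    by_contra! h
    exact h1 (Sp_ext fun x => by rw [htx, h, add_zero]; rfl)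
  have hR : IsTotallyIsotropic B (LinearMap.range N) := by
    rintro _ ⟨x, rfl⟩ _ ⟨y, rfl⟩
    rw [hself, hNN, map_zero]
  have hr : Module.finrank K (LinearMap.range N) = 1 ∨ Module.finrank K (LinearMap.range N) = 2 := by
    have h := hR.finrank_le_two hV hnd
    have h0 : Module.finrank K (LinearMap.range N) ≠ 0 := by
      rw [Ne, Submodule.finrank_eq_zero, LinearMap.range_eq_bot]
      rintro h
      obtain ⟨x, hx⟩ := hNne
      exact hx (by rw [h]; rfl)
    omega
  rcases hr with hr | hr
  · obtain ⟨v, hv, hs⟩ := exists_of_finrank_eq_one hr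
    obtain ⟨w, hw⟩ := exists_form_eq hnd (v := ![v]) (by simpa using hv) ![1]
    have hw : B w v = 1 := hw 0
    have hl : ∀ x, ∃ l : K, l • v = N x := fun x =>
      Submodule.mem_span_singleton.1 (hs ▸ ⟨x, rfl⟩)
    obtain ⟨c, hc⟩ := hl w
    have hform : ∀ x, N x = (c * B x v) • v := fun x => by
      obtain ⟨l, hl⟩ := hl x
      have := hself w x
      rw [← hl, ← hc, map_smul, map_smul, LinearMap.smul_apply, smul_eq_mul, smul_eq_mul, hw,
        mul_one, alt_comm hB] at this
      rw [← hl, this]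
    refine ⟨_, Or.inl ⟨v, c, hv, ?_, rfl, fun x => by rw [htx, hform]⟩⟩
    rintro rfl
    obtain ⟨x, hx⟩ := hNne
    exact hx (by rw [hform]; simp)
  · obtain ⟨a, b, hab, hs⟩ := exists_pair_of_finrank_eq_two hr
    obtain ⟨y₁, hy₁⟩ := exists_form_eq hnd hab ![1, 0]
    obtain ⟨y₂, hy₂⟩ := exists_form_eq hnd hab ![0, 1]
    have hy₁a : B y₁ a = 1 := hy₁ 0
    have hy₁b : B y₁ b = 0 := hy₁ 1
    have hy₂a : B y₂ a = 0 := hy₂ 0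
    have hy₂b : B y₂ b = 1 := hy₂ 1
    have hmem : ∀ x, ∃ l m : K, l • a + m • b = N x := fun x =>
      Submodule.mem_span_pair.1 (hs ▸ ⟨x, rfl⟩)
    have haR : a ∈ LinearMap.range N := hs ▸ Submodule.subset_span (by simp)
    have hbR : b ∈ LinearMap.range N := hs ▸ Submodule.subset_span (by simp)
    obtain ⟨p, q, hpq⟩ := hmem y₁
    obtain ⟨q', r, hqr⟩ := hmem y₂
    -- Self-adjointness makes the matrix of the form `B x (N y)` in the coordinates `B x a`, `B x b`
    -- symmetric.
    have hqq : q' = q := by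
      have := hself y₁ y₂
      simp only [← hpq, ← hqr, map_add, map_smul, LinearMap.add_apply, LinearMap.smul_apply,
        alt_comm hB a, alt_comm hB b, smul_eq_mul, hy₁a, hy₁b, hy₂a, hy₂b] at this
      linear_combination -this
    subst hqq
    have hform : ∀ x, N x = (p * B x a + q' * B x b) • a + (q' * B x a + r * B x b) • b := by
      intro x
      obtain ⟨l, m, hlm⟩ := hmem x
      have e1 := hself y₁ x
      have e2 := hself y₂ x
      simp only [← hpq, ← hqr, ← hlm, map_add, map_smul, LinearMap.add_apply, LinearMap.smul_apply,
        smul_eq_mul, hy₁a, hy₁b, hy₂a, hy₂b, alt_comm hB a x, alt_comm hB b x] at e1 e2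
      rw [← hlm]
      congr 2
      · linear_combination -e1
      · linear_combination -e2
    have hchar : ringChar K = 2 := ringChar.eq K 2
    -- The diagonal entries are squares, so the quadratic form `B x (N x)` is the square of a linear
    -- form. It vanishes exactly for short root elements.
    obtain ⟨α, rfl⟩ := FiniteField.isSquare_of_char_two hchar p
    obtain ⟨β, rfl⟩ := FiniteField.isSquare_of_char_two hchar r
    by_cases hαβ : α = 0 ∧ β = 0
    · obtain ⟨rfl, rfl⟩ := hαβ
      have hq0 : q' ≠ 0 := by
        rintro rfl
        obtain ⟨x, hx⟩ := hNne
        exact hx (by rw [hform]; simp)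
      refine ⟨_, Or.inr ⟨a, q' • b, ?_, ?_, rfl, fun x => ?_⟩⟩
      · have := hab.units_smul ![1, Units.mk0 q' hq0]
        convert this using 1
        ext i; fin_cases i <;> simp [Units.smul_def]
      · rw [map_smul, hR a haR b hbR, smul_zero]
      · rw [htx, hform, map_smul, smul_eq_mul]
        module
    -- With a nonzero diagonal, `g` fixes the nonzero vector `d` of the line `range N` and has
    -- determinant `1` there. It is then unipotent on that line, hence trivial on it because `g³ =
    -- 1`, and so trivial on `V`.
    · exfalso
      set d := α • a + β • b with hd
      have two0 := CharTwo.two_eq_zero (R := K)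
      -- `g` fixes `d`, because `B x (N x) = (B x d) ^ 2`
      have hf : ∀ x, B x (N x) = B x d ^ 2 := fun x => by
        rw [hform, hd]
        simp only [map_add, map_smul, smul_eq_mul]
        linear_combination (q' * B x a * B x b - α * β * B x a * B x b) * two0
      have hgd : g.1 d = d := by
        have h : ∀ x, B x (g.1 d - d) = 0 := fun x => by
          rw [map_sub, sub_eq_zero]
          have e : B x (g.1 d) ^ 2 = B x d ^ 2 := by
            rw [form_apply_right, ← hf, ← hf]
            conv_rhs => rw [← apply_inv_apply g x, ← hgN]
            exact (g.2 _ _).symm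
          exact CharTwo.sq_injective e
        have := hnd.2 _ h
        exact sub_eq_zero.1 this
      set k := q' + α * β with hk
      have hN2 : ∀ x, N x = B x d • d + k • (B x a • b + B x b • a) := fun x => by
        rw [hform, hd, hk]
        simp only [map_add, map_smul, smul_eq_mul]
        have e1 := congrArg (fun z => (z * (α * β * B x b)) • a) two0
        have e2 := congrArg (fun z => (z * (α * β * B x a)) • b) two0
        simp only [zero_mul, zero_smul] at e1 e2
        linear_combination (norm := module) - e1 - e2
      -- Otherwise `N` would have rank at most `1`.
      have hk0 : k ≠ 0 := by
        intro h0
        have hle : LinearMap.range N ≤ Submodule.span K {d} := by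
          rintro _ ⟨x, rfl⟩
          rw [hN2, h0, zero_smul, add_zero]
          exact Submodule.smul_mem _ _ (Submodule.mem_span_singleton_self d)
        have h3 := Submodule.finrank_mono hle
        have h4 := finrank_span_le_card (R := K) ({d} : Set V)
        simp at h4
        omega
      have hgR : ∀ x ∈ LinearMap.range N, ∃ l m : K, l • a + m • b = g.1 x := by
        rintro _ ⟨x, rfl⟩
        obtain ⟨l, m, h⟩ := hmem (g.1 x)
        exact ⟨l, m, by rw [h, hgN]⟩
      obtain ⟨p₁, q₁, hga⟩ := hgR a haR
      obtain ⟨r₁, s₁, hgb⟩ := hgR b hbR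
      -- `g` commutes with `N` and with `x ↦ B x d • d`, hence with the remaining alternating part
      -- of `N`. This gives determinant `1` on the line.
      have hS : ∀ x, B x a • g.1 b + B x b • g.1 a = B (g.1 x) a • b + B (g.1 x) b • a := fun x => by
        have h := hgN x
        have e : B (g.1 x) d = B x d := by
          conv_lhs => rw [← hgd]
          exact g.2 _ _
        rw [hN2, hN2, map_add, map_smul, hgd, e, add_right_inj, map_smul] at h
        have := smul_right_injective V hk0 h
        simpa only [map_add, map_smul] using this
      have hli := LinearIndependent.pair_iff.1 hab
      have hdet : p₁ * s₁ + q₁ * r₁ = 1 := by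
        have h := hS ((g⁻¹).1 y₁)
        rw [apply_inv_apply, ← form_apply_right, ← form_apply_right, ← hga, ← hgb, hy₁a, hy₁b] at h
        simp only [map_add, map_smul, hy₁a, hy₁b, smul_eq_mul] at h
        have e1 := congrArg (fun z => (z * (p₁ * r₁)) • a) two0
        simp only [zero_mul, zero_smul] at e1
        have := (hli 0 (p₁ * s₁ + q₁ * r₁ - 1) (by
          linear_combination (norm := module) h - e1)).2
        linear_combination this
      have hfix : (α * p₁ + β * r₁ - α) = 0 ∧ (α * q₁ + β * s₁ - β) = 0 := by
        refine hli _ _ ?_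
        have h := hgd
        rw [hd, map_add, map_smul, map_smul, ← hga, ← hgb] at h
        linear_combination (norm := module) h
      -- The fixed vector `d` makes `1` a root of the characteristic polynomial; with determinant
      -- `1` the trace is `2 = 0`. Cayley–Hamilton then gives `g² = 1` on the line.
      have htr : p₁ + s₁ = 0 := by
        have h : (p₁ - 1) * (s₁ - 1) - q₁ * r₁ = 0 := by
          by_contra hne
          refine hαβ ⟨?_, ?_⟩
          · refine (mul_eq_zero.1 ?_).resolve_right hne
            linear_combination (s₁ - 1) * hfix.1 - r₁ * hfix.2
          · refine (mul_eq_zero.1 ?_).resolve_right hne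
            linear_combination (p₁ - 1) * hfix.2 - q₁ * hfix.1
        linear_combination hdet - h + (1 - q₁ * r₁) * two0
      have hggR : ∀ x ∈ LinearMap.range N, g.1 (g.1 x) = x := by
        have hgga : g.1 (g.1 a) = a := by
          rw [← hga, map_add, map_smul, map_smul, ← hga, ← hgb]
          have e : p₁ * p₁ + q₁ * r₁ - 1 = 0 := by linear_combination hdet + p₁ * htr - p₁ * s₁ * two0
          have e1 := congrArg (fun z => z • a) e
          have e2 := congrArg (fun z => (q₁ * z) • b) htr
          simp only [mul_zero, zero_smul] at e1 e2
          linear_combination (norm := module) e1 + e2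
        have hggb : g.1 (g.1 b) = b := by
          rw [← hgb, map_add, map_smul, map_smul, ← hga, ← hgb]
          have e : s₁ * s₁ + q₁ * r₁ - 1 = 0 := by linear_combination hdet + s₁ * htr - p₁ * s₁ * two0
          have e1 := congrArg (fun z => z • b) e
          have e2 := congrArg (fun z => (r₁ * z) • a) htr
          simp only [mul_zero, zero_smul] at e1 e2
          linear_combination (norm := module) e1 + e2
        intro x hx
        rw [hs] at hx
        obtain ⟨l, m, rfl⟩ := Submodule.mem_span_pair.1 hx
        simp only [map_add, map_smul, hgga, hggb]
      exact hg1 (eq_one_of_trivial_on_line hV hnd hR hr hgg hggR)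

end Involutions

/-! ### Cyclic symplectic bases and transitivity on points and on lines. -/

section CyclicBases

/-- A symplectic basis, ordered so that opposite vectors of the `4`-cycle are the hyperbolic pairs.
In characteristic `2` every symmetry of the `4`-cycle is an isometry. -/
def IsCyclicBasis (B : LinearMap.BilinForm K V) (v : Fin 4 → V) : Prop :=
  ∀ i j, B (v i) (v j) = if j = i + 2 then 1 else 0

variable {v w : Fin 4 → V}

theorem IsCyclicBasis.linearIndependent (hv : IsCyclicBasis B v) : LinearIndependent K v := by
  rw [Fintype.linearIndependent_iff]
  intro c hc j
  have h := congrArg (B (v (j + 2))) hc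
  rw [map_sum, map_zero] at h
  simp only [map_smul, hv _ _, smul_eq_mul, mul_ite, mul_one, mul_zero] at h
  have e : ∀ i, (i = j + 2 + 2) ↔ (i = j) := by clear h hc; revert j; decide
  simpa [e] using h

/-- A cyclic basis as a basis. -/
noncomputable def IsCyclicBasis.basis (hv : IsCyclicBasis B v) (hV : Module.finrank K V = 4) :
    Module.Basis (Fin 4) K V :=
  basisOfLinearIndependentOfCardEqFinrank hv.linearIndependent (by simp [hV])

theorem IsCyclicBasis.basis_apply (hv : IsCyclicBasis B v) (hV : Module.finrank K V = 4)
    (i : Fin 4) : hv.basis hV i = v i := by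
  simp [IsCyclicBasis.basis]

theorem IsCyclicBasis.basis_repr (hv : IsCyclicBasis B v) (hV : Module.finrank K V = 4) (x : V)
    (j : Fin 4) : (hv.basis hV).repr x j = B (v (j + 2)) x := by
  conv_rhs => rw [← (hv.basis hV).sum_repr x]
  simp only [map_sum, map_smul, hv.basis_apply, hv _ _, smul_eq_mul, mul_ite, mul_one, mul_zero]
  have e : ∀ i, (i = j + 2 + 2) ↔ (i = j) := by revert j; decide
  simp [e]

theorem IsCyclicBasis.expand (hv : IsCyclicBasis B v) (hV : Module.finrank K V = 4) (x : V) :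
    x = B (v 2) x • v 0 + B (v 3) x • v 1 + B (v 0) x • v 2 + B (v 1) x • v 3 := by
  conv_lhs => rw [← (hv.basis hV).sum_repr x]
  simp only [Fin.sum_univ_four, hv.basis_repr, hv.basis_apply]
  rfl

theorem IsCyclicBasis.form_eq (hv : IsCyclicBasis B v) (hV : Module.finrank K V = 4) (x y : V) :
    B x y = B (v 2) x * B (v 0) y + B (v 3) x * B (v 1) y + B (v 0) x * B (v 2) y +
      B (v 1) x * B (v 3) y := by
  conv_lhs => rw [hv.expand hV x]
  simp only [map_add, map_smul, LinearMap.add_apply, LinearMap.smul_apply, smul_eq_mul]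

theorem IsCyclicBasis.ne_zero (hv : IsCyclicBasis B v) (i : Fin 4) : v i ≠ 0 :=
  hv.linearIndependent.ne_zero i

theorem IsCyclicBasis.exists_isometry (hv : IsCyclicBasis B v) (hw : IsCyclicBasis B w)
    (hV : Module.finrank K V = 4) : ∃ g : Sp B, ∀ i, g.1 (v i) = w i := by
  let e : V ≃ₗ[K] V := (hv.basis hV).equiv (hw.basis hV) (Equiv.refl _)
  have he : ∀ i, e (v i) = w i := fun i => by
    have := (hv.basis hV).equiv_apply i (hw.basis hV) (Equiv.refl _)
    rwa [hv.basis_apply, Equiv.refl_apply, hw.basis_apply] at this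
  refine ⟨⟨e, fun x y => ?_⟩, he⟩
  have h : B.compl₁₂ (e : V →ₗ[K] V) (e : V →ₗ[K] V) = B := by
    refine (hv.basis hV).ext fun i => (hv.basis hV).ext fun j => ?_
    simp only [LinearMap.compl₁₂_apply, hv.basis_apply, LinearEquiv.coe_coe, he]
    rw [hv, hw]
  exact LinearMap.congr_fun₂ h x y

theorem IsCyclicBasis.Sp_ext (hv : IsCyclicBasis B v) (hV : Module.finrank K V = 4) {g h : Sp B}
    (H : ∀ i, g.1 (v i) = h.1 (v i)) : g = h := by
  refine Subtype.ext (LinearEquiv.toLinearMap_injective ((hv.basis hV).ext fun i => ?_))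
  rw [hv.basis_apply]
  exact H i

theorem IsCyclicBasis.comp (hv : IsCyclicBasis B v) {f : Fin 4 → Fin 4}
    (hf : ∀ i j, f j = f i + 2 ↔ j = i + 2) : IsCyclicBasis B (v ∘ f) := fun i j => by
  simp only [Function.comp, hv _ _, hf]

theorem exists_perp_independent [FiniteDimensional K V]
    (hV : Module.finrank K V = 4) (hnd : B.Nondegenerate) {a : V} (ha : a ≠ 0) :
    ∃ b, LinearIndependent K ![a, b] ∧ B a b = 0 := by
  have h : ¬ B.orthogonal (Submodule.span K {a}) ≤ Submodule.span K {a} := by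
    intro h
    have := Submodule.finrank_mono h
    rw [LinearMap.BilinForm.finrank_orthogonal hnd, hV, finrank_span_singleton ha] at this
    omega
  obtain ⟨b, hb, hb'⟩ := SetLike.not_le_iff_exists.1 h
  refine ⟨b, ?_, mem_perp_span_singleton.1 hb⟩
  rw [LinearIndependent.pair_iff' ha]
  intro c hc
  exact hb' (Submodule.mem_span_singleton.2 ⟨c, hc⟩)

variable [CharP K 2]

theorem isCyclicBasis_of (hB : B.IsAlt) {a b c d : V} (hab : B a b = 0) (hac : B a c = 1)
    (had : B a d = 0) (hbc : B b c = 0) (hbd : B b d = 1) (hcd : B c d = 0) :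
    IsCyclicBasis B ![a, b, c, d] := by
  have h := alt_comm hB
  intro i j
  fin_cases i <;> fin_cases j <;>
    simp [hB.self_eq_zero, hab, hac, had, hbc, hbd, hcd, h b a, h c a, h d a, h c b, h d b, h d c]

theorem exists_fourth (hB : B.IsAlt) [FiniteDimensional K V] (hnd : B.Nondegenerate) {a b c : V}
    (hb : b ≠ 0) (hab : B a b = 0) (hac : B a c = 1) (hbc : B b c = 0) :
    ∃ d, B a d = 0 ∧ B b d = 1 ∧ B c d = 0 := by
  obtain ⟨d, hd⟩ := exists_form_eq hnd (v := ![b]) (by simpa using hb) ![1]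
  have hd : B d b = 1 := hd 0
  rw [alt_comm hB] at hd
  -- Gram–Schmidt against the hyperbolic pair `a, c`, which is orthogonal to `b`.
  refine ⟨d + B a d • c + B c d • a, ?_, ?_, ?_⟩
  · simp [hac, hB.self_eq_zero, CharTwo.add_self_eq_zero]
  · simp [hd, hbc, alt_comm hB b a, hab]
  · simp [hB.self_eq_zero, alt_comm hB c a, hac, CharTwo.add_self_eq_zero]

theorem exists_third (hB : B.IsAlt) [FiniteDimensional K V] (hnd : B.Nondegenerate) {a b : V}
    (hab : LinearIndependent K ![a, b]) : ∃ c, B a c = 1 ∧ B b c = 0 := by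
  obtain ⟨c, hc⟩ := exists_form_eq hnd hab ![1, 0]
  exact ⟨c, by rw [alt_comm hB]; exact hc 0, by rw [alt_comm hB]; exact hc 1⟩

theorem exists_isCyclicBasis (hB : B.IsAlt) [FiniteDimensional K V] (hnd : B.Nondegenerate)
    {a b : V} (hab : LinearIndependent K ![a, b]) (h : B a b = 0) :
    ∃ v, IsCyclicBasis B v ∧ v 0 = a ∧ v 1 = b := by
  obtain ⟨c, hac, hbc⟩ := exists_third hB hnd hab
  obtain ⟨d, had, hbd, hcd⟩ := exists_fourth hB hnd (hab.ne_zero 1) h hac hbc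
  exact ⟨_, isCyclicBasis_of hB h hac had hbc hbd hcd, rfl, rfl⟩

/-- Every totally isotropic point or line is the first one of a cyclic basis. -/
theorem PointLine.exists_isCyclicBasis (hB : B.IsAlt) [FiniteDimensional K V]
    (hV : Module.finrank K V = 4) (hnd : B.Nondegenerate) (X : PointLine B) :
    ∃ v, IsCyclicBasis B v ∧
      (Module.finrank K X.1 = 1 ∧ X.1 = Submodule.span K {v 0} ∨
        Module.finrank K X.1 = 2 ∧ X.1 = Submodule.span K {v 0, v 1}) := by
  obtain ⟨X, hX, h | h⟩ := X
  · obtain ⟨a, ha, rfl⟩ := exists_of_finrank_eq_one h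
    obtain ⟨b, hab, h0⟩ := exists_perp_independent hV hnd ha
    obtain ⟨v, hv, rfl, -⟩ := SymplecticFlags.exists_isCyclicBasis hB hnd hab h0
    exact ⟨v, hv, Or.inl ⟨h, rfl⟩⟩
  · obtain ⟨a, b, hab, rfl⟩ := exists_pair_of_finrank_eq_two h
    obtain ⟨v, hv, rfl, rfl⟩ := SymplecticFlags.exists_isCyclicBasis hB hnd hab
      (hX a (Submodule.subset_span (by simp)) b (Submodule.subset_span (by simp)))
    exact ⟨v, hv, Or.inr ⟨h, rfl⟩⟩

theorem PointLine.exists_map_eq (hB : B.IsAlt) [FiniteDimensional K V]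
    (hV : Module.finrank K V = 4) (hnd : B.Nondegenerate) {X Y : PointLine B}
    (h : Module.finrank K X.1 = Module.finrank K Y.1) :
    ∃ g : Sp B, X.1.map (g.1 : V →ₗ[K] V) = Y.1 := by
  obtain ⟨v, hv, hX⟩ := X.exists_isCyclicBasis hB hV hnd
  obtain ⟨w, hw, hY⟩ := Y.exists_isCyclicBasis hB hV hnd
  obtain ⟨g, hg⟩ := hv.exists_isometry hw hV
  refine ⟨g, ?_⟩
  rcases hX with ⟨hx, hX⟩ | ⟨hx, hX⟩ <;> rcases hY with ⟨hy, hY⟩ | ⟨hy, hY⟩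
  · rw [hX, hY, Submodule.map_span, Set.image_singleton, LinearEquiv.coe_coe, hg]
  · omega
  · omega
  · rw [hX, hY, Submodule.map_span, Set.image_pair, LinearEquiv.coe_coe, hg, hg]

/-- Every totally isotropic point or line is the centre of a root element that commutes with an
element of order `3`. -/
theorem PointLine.exists_isRootElement (hB : B.IsAlt) [FiniteDimensional K V]
    (hV : Module.finrank K V = 4) (hnd : B.Nondegenerate) (X : PointLine B) :
    ∃ t g : Sp B, IsRootElement t X.1 ∧ g ≠ 1 ∧ g * g * g = 1 ∧ g * t = t * g := by
  obtain ⟨v, hv, hX⟩ := X.exists_isCyclicBasis hB hV hnd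
  rcases hX with ⟨-, hX⟩ | ⟨-, hX⟩
  · obtain ⟨t, ht⟩ := exists_transvection hB (v 0) 1
    -- An element of order `3` on the hyperbolic plane of `v 1, v 3`, fixing `v 0` and `v 2`.
    have hw : IsCyclicBasis B ![v 0, v 3, v 2, v 1 + v 3] := by
      apply isCyclicBasis_of hB <;> simp [hv _ _]
    obtain ⟨g, hg⟩ := hv.exists_isometry hw hV
    have h0 : g.1 (v 0) = v 0 := hg 0
    have h1 : g.1 (v 1) = v 3 := hg 1
    have h2 : g.1 (v 2) = v 2 := hg 2
    have h3 : g.1 (v 3) = v 1 + v 3 := hg 3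
    refine ⟨t, g, Or.inl ⟨v 0, 1, hv.ne_zero 0, one_ne_zero, hX, ht⟩, ?_, ?_, ?_⟩
    · rintro rfl
      exact absurd (hv.linearIndependent.injective h1) (by decide)
    · refine hv.Sp_ext hV fun i => ?_
      change g.1 (g.1 (g.1 (v i))) = v i
      have h33 := add_self_char_two (K := K) (v 3)
      fin_cases i <;> simp [h0, h1, h2, h3]
      · rw [add_left_comm, h33, add_zero]
      · have h11 := add_self_char_two (K := K) (v 1)
        linear_combination (norm := module) h11 + h33
    · refine Sp_ext fun x => ?_
      change g.1 (t.1 x) = t.1 (g.1 x)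
      rw [ht, ht, map_add, map_smul, h0]
      have e : B (g.1 x) (v 0) = B x (v 0) := by
        conv_lhs => rw [← h0]
        exact g.2 _ _
      rw [e]
  · have h01 : B (v 0) (v 1) = 0 := by simp [hv _ _]
    have hli : LinearIndependent K ![v 0, v 1] := by
      have := hv.linearIndependent.comp ![0, 1] (by decide)
      convert this using 1
      ext i; fin_cases i <;> rfl
    obtain ⟨t, ht⟩ := exists_double_transvection hB h01
    -- An element of order `3` and determinant `1` on the line of `v 0, v 1`, extended
    -- contragrediently to `v 2, v 3`.
    have hw : IsCyclicBasis B ![v 1, v 0 + v 1, v 2 + v 3, v 2] := by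
      apply isCyclicBasis_of hB <;> simp [hv _ _, CharTwo.add_self_eq_zero]
    obtain ⟨g, hg⟩ := hv.exists_isometry hw hV
    have h0 : g.1 (v 0) = v 1 := hg 0
    have h1 : g.1 (v 1) = v 0 + v 1 := hg 1
    have h2 : g.1 (v 2) = v 2 + v 3 := hg 2
    have h3 : g.1 (v 3) = v 2 := hg 3
    have e0 := add_self_char_two (K := K) (v 0)
    have e1 := add_self_char_two (K := K) (v 1)
    have e2 := add_self_char_two (K := K) (v 2)
    have e3 := add_self_char_two (K := K) (v 3)
    refine ⟨t, g, Or.inr ⟨v 0, v 1, hli, h01, hX, ht⟩, ?_, ?_, ?_⟩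
    · rintro rfl
      exact absurd (hv.linearIndependent.injective h0) (by decide)
    · refine hv.Sp_ext hV fun i => ?_
      change g.1 (g.1 (g.1 (v i))) = v i
      fin_cases i <;> simp only [Fin.zero_eta, Fin.mk_one, Fin.reduceFinMk, h0, h1, h2, h3, map_add]
      · linear_combination (norm := module) e1
      · linear_combination (norm := module) e0 + e1
      · linear_combination (norm := module) e2 + e3
      · linear_combination (norm := module) e2
    · refine Sp_ext fun x => ?_
      change g.1 (t.1 x) = t.1 (g.1 x)
      have hb : B (g.1 x) (v 1) = B x (v 0) := by
        conv_lhs => rw [← h0]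
        exact g.2 _ _
      have ha : B (g.1 x) (v 0) = B x (v 0) + B x (v 1) := by
        have h : v 0 = g.1 (v 0 + v 1) := by
          rw [map_add, h0, h1]
          linear_combination (norm := module) -e1
        conv_lhs => rw [h]
        rw [g.2, map_add]
      rw [ht, ht, ha, hb, map_add, map_add, map_smul, map_smul, h0, h1]
      module

end CyclicBases

/-! ### The induced action on points and lines, and its preservation of incidence. -/

section Action

variable [CharP K 2] [FiniteDimensional K V] [Finite K]

/-- Automorphisms of `Sp(V)` permute the root elements, and hence the stabilisers of totally
isotropic points and lines. -/
theorem exists_isRootElement_map (hV : Module.finrank K V = 4) (hB : B.IsAlt)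
    (hnd : B.Nondegenerate) (φ : MulAut (Sp B)) (X : PointLine B) :
    ∃ (t : Sp B) (Y : PointLine B), IsRootElement t X.1 ∧ IsRootElement (φ t) Y.1 ∧
      stab B Y.1 = (stab B X.1).map φ.toMonoidHom := by
  obtain ⟨t, g, ht, hg1, hg3, hgt⟩ := X.exists_isRootElement hB hV hnd
  obtain ⟨Y, hY⟩ := SymplecticFlags.exists_isRootElement hV hB hnd (t := φ t) (g := φ g)
    (by rw [Ne, EmbeddingLike.map_eq_one_iff]; exact ht.ne_one hB hnd)
    (by rw [← map_mul, ht.mul_self hB, map_one])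
    (by rwa [Ne, EmbeddingLike.map_eq_one_iff])
    (by rw [← map_mul, ← map_mul, hg3, map_one])
    (by rw [← map_mul, ← map_mul, hgt])
  refine ⟨t, ⟨Y, hY.pointLine hB⟩, ht, hY, ?_⟩
  ext h
  obtain ⟨h, rfl⟩ := φ.surjective h
  rw [hY.mem_stab_iff hB hnd, normalizesCentralizer_map, ← ht.mem_stab_iff hB hnd]
  exact (Subgroup.mem_map_iff_mem (f := φ.toMonoidHom) φ.injective).symm

theorem exists_isInducedAction (hV : Module.finrank K V = 4) (hB : B.IsAlt)
    (hnd : B.Nondegenerate) :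
    ∃ ρ : MulAut (Sp B) →* Equiv.Perm (PointLine B), IsInducedAction B ρ := by
  have H : ∀ (φ : MulAut (Sp B)) (X : PointLine B), ∃ Y : PointLine B,
      stab B Y.1 = (stab B X.1).map φ.toMonoidHom := fun φ X => by
    obtain ⟨-, Y, -, -, h⟩ := exists_isRootElement_map hV hB hnd φ X
    exact ⟨Y, h⟩
  choose f hf using H
  have hone : ∀ X, f 1 X = X := fun X => stab_injective hB hnd <| by
    rw [hf]; exact Subgroup.map_id _
  have hmul : ∀ φ ψ X, f (φ * ψ) X = f φ (f ψ X) := fun φ ψ X => stab_injective hB hnd <| by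
    rw [hf, hf, hf, Subgroup.map_map]; rfl
  refine ⟨{ toFun := fun φ => ⟨f φ, f φ⁻¹, fun X => ?_, fun X => ?_⟩, map_one' := ?_,
            map_mul' := ?_ }, hf⟩
  · rw [← hmul, inv_mul_cancel, hone]
  · rw [← hmul, mul_inv_cancel, hone]
  · ext1 X; exact hone X
  · intro φ ψ; ext1 X; exact hmul φ ψ X

variable {ρ : MulAut (Sp B) →* Equiv.Perm (PointLine B)}

omit [Finite K] in
theorem IsInducedAction.unique (hB : B.IsAlt) (hnd : B.Nondegenerate) (hρ : IsInducedAction B ρ)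
    {ρ' : MulAut (Sp B) →* Equiv.Perm (PointLine B)} (hρ' : IsInducedAction B ρ') : ρ' = ρ := by
  ext1 φ
  ext1 X
  exact stab_injective hB hnd (by rw [hρ, hρ'])

omit [CharP K 2] [FiniteDimensional K V] [Finite K] in
theorem IsInducedAction.apply_mem_stab_iff (hρ : IsInducedAction B ρ) (φ : MulAut (Sp B))
    (X : PointLine B) (g : Sp B) : φ g ∈ stab B (ρ φ X).1 ↔ g ∈ stab B X.1 := by
  rw [hρ]
  exact Subgroup.mem_map_iff_mem (f := φ.toMonoidHom) φ.injective

omit [Finite K] in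
theorem IsInducedAction.conj_apply (hB : B.IsAlt) (hnd : B.Nondegenerate)
    (hρ : IsInducedAction B ρ) (g : Sp B) (X : PointLine B) :
    (ρ (MulAut.conj g) X).1 = X.1.map (g.1 : V →ₗ[K] V) := by
  let Y : PointLine B := ⟨X.1.map (g.1 : V →ₗ[K] V), by
    refine ⟨?_, ?_⟩
    · rintro _ ⟨x, hx, rfl⟩ _ ⟨y, hy, rfl⟩
      exact (g.2 x y).trans (X.2.1 x hx y hy)
    · rw [show Module.finrank K (X.1.map (g.1 : V →ₗ[K] V)) = _ from LinearEquiv.finrank_map_eq g.1 X.1]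
      exact X.2.2⟩
  suffices h : ρ (MulAut.conj g) X = Y from congrArg Subtype.val h
  apply stab_injective hB hnd
  rw [hρ]
  ext h
  obtain ⟨h, rfl⟩ := (MulAut.conj g).surjective h
  rw [show (MulAut.conj g) h ∈ (stab B X.1).map (MulAut.conj g).toMonoidHom ↔ _ from
    Subgroup.mem_map_iff_mem (f := (MulAut.conj g).toMonoidHom) (MulAut.conj g).injective]
  have e : ∀ x, ((MulAut.conj g) h).1 (g.1 x) = g.1 (h.1 x) := fun x => by
    change g.1 (h.1 ((g⁻¹).1 (g.1 x))) = _
    rw [inv_apply_apply]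
  constructor
  · intro hh
    refine mem_stab ?_
    rintro _ ⟨x, hx, rfl⟩
    exact ⟨h.1 x, apply_mem_of_mem_stab hh hx, (e x).symm⟩
  · intro hh
    refine mem_stab fun x hx => ?_
    obtain ⟨y, hy, hyx⟩ := apply_mem_of_mem_stab hh (x := g.1 x) ⟨x, hx, rfl⟩
    rw [e] at hyx
    rwa [← g.1.injective hyx]

omit [Finite K] in
-- `Sp(V)` is transitive on the points and on the lines, and `φ` carries inner automorphisms to
-- inner ones, so images of two elements of one type differ by an isometry. Points and lines may
-- still be exchanged.
theorem IsInducedAction.finrank_eq (hV : Module.finrank K V = 4) (hB : B.IsAlt)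
    (hnd : B.Nondegenerate) (hρ : IsInducedAction B ρ) (φ : MulAut (Sp B)) {X Y : PointLine B}
    (h : Module.finrank K X.1 = Module.finrank K Y.1) :
    Module.finrank K (ρ φ X).1 = Module.finrank K (ρ φ Y).1 := by
  obtain ⟨g, hg⟩ := PointLine.exists_map_eq hB hV hnd h
  have e : ρ (MulAut.conj g) X = Y := Subtype.ext (by rw [hρ.conj_apply hB hnd, hg])
  have e2 : ρ φ Y = ρ (MulAut.conj (φ g)) (ρ φ X) := by
    rw [← e, ← Equiv.Perm.mul_apply, ← Equiv.Perm.mul_apply, ← map_mul, ← map_mul]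
    congr 2
    ext1 h
    simp
  rw [e2, hρ.conj_apply hB hnd]
  exact (LinearEquiv.finrank_map_eq (φ g).1 (ρ φ X).1).symm

omit [Finite K] in
theorem IsInducedAction.finrank_ne (hV : Module.finrank K V = 4) (hB : B.IsAlt)
    (hnd : B.Nondegenerate) (hρ : IsInducedAction B ρ) (φ : MulAut (Sp B)) {X Y : PointLine B}
    (h : Module.finrank K X.1 ≠ Module.finrank K Y.1) :
    Module.finrank K (ρ φ X).1 ≠ Module.finrank K (ρ φ Y).1 := by
  intro h'
  have := hρ.finrank_eq hV hB hnd φ⁻¹ h'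
  rw [← Equiv.Perm.mul_apply, ← Equiv.Perm.mul_apply, ← map_mul, inv_mul_cancel, map_one] at this
  exact h this

omit [Finite K] in
/-- A root element with centre `X` stabilises a `Y` of the other type only if `X` and `Y` are
incident. -/
theorem IsRootElement.comparable (hV : Module.finrank K V = 4) (hB : B.IsAlt)
    (hnd : B.Nondegenerate) {t : Sp B} {X Y : PointLine B} (ht : IsRootElement t X.1)
    (hY : t ∈ stab B Y.1) (hne : Module.finrank K X.1 ≠ Module.finrank K Y.1) :
    X.1 ≤ Y.1 ∨ Y.1 ≤ X.1 := by
  by_cases hfix : ∀ y ∈ Y.1, t.1 y = y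
  · have hYX : Y.1 ≤ B.orthogonal X.1 := fun y hy => (ht.apply_eq_self_iff hB y).1 (hfix y hy)
    rcases X.2.2 with hX2 | hX2
    · have hY2 : Module.finrank K Y.1 = 2 := by
        have := Y.2.2
        omega
      left
      rw [← Y.2.1.orthogonal_eq hV hnd hY2]
      intro x hx
      rw [LinearMap.BilinForm.mem_orthogonal_iff]
      intro y hy
      have h := LinearMap.BilinForm.mem_orthogonal_iff.1 (hYX hy) x hx
      rw [← hB.neg_eq, h, neg_zero]
    · right
      rwa [X.2.1.orthogonal_eq hV hnd hX2] at hYX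
  -- The nonzero vector `t y - y` lies in both `X` and `Y`, one of which is a point.
  · push Not at hfix
    obtain ⟨y, hy, hne'⟩ := hfix
    have hzX := ht.apply_sub_mem y
    have hzY : t.1 y - y ∈ Y.1 := sub_mem (apply_mem_of_mem_stab hY hy) hy
    have hz := sub_ne_zero.2 hne'
    have key : ∀ {Z Z' : Submodule K V}, Module.finrank K Z = 1 → t.1 y - y ∈ Z →
        t.1 y - y ∈ Z' → Z ≤ Z' := by
      intro Z Z' h1 hZ hZ' w hw
      obtain ⟨c, hc⟩ := exists_smul_eq_of_finrank_eq_one h1 (x := ⟨_, hZ⟩)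
        (by simpa using hz) ⟨w, hw⟩
      have hc : c • (t.1 y - y) = w := congrArg Subtype.val hc
      rw [← hc]
      exact Z'.smul_mem c hZ'
    rcases X.2.2 with hX1 | hX2
    · exact Or.inl (key hX1 hzX hzY)
    · refine Or.inr (key ?_ hzY hzX)
      have := Y.2.2
      omega

omit [Finite K] in
theorem IsRootElement.mem_stab_of_le (hB : B.IsAlt) {t : Sp B} {X Y : PointLine B}
    (ht : IsRootElement t X.1) (h : X.1 ≤ Y.1) : t ∈ stab B Y.1 := by
  refine mem_stab fun y hy => ?_
  rwa [(ht.apply_eq_self_iff hB y).2 (LinearMap.BilinForm.mem_orthogonal_iff.2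
    fun x hx => Y.2.1 x (h hx) y hy)]

/-- The induced action preserves incidence. -/
theorem IsInducedAction.comparable (hV : Module.finrank K V = 4) (hB : B.IsAlt)
    (hnd : B.Nondegenerate) (hρ : IsInducedAction B ρ) (φ : MulAut (Sp B)) {X Y : PointLine B}
    (h : X.1 ≤ Y.1) (hne : Module.finrank K X.1 ≠ Module.finrank K Y.1) :
    (ρ φ X).1 ≤ (ρ φ Y).1 ∨ (ρ φ Y).1 ≤ (ρ φ X).1 := by
  obtain ⟨t, Z, ht, htZ, hZ⟩ := exists_isRootElement_map hV hB hnd φ X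
  obtain rfl : Z = ρ φ X := stab_injective hB hnd (by rw [hZ, hρ])
  exact htZ.comparable hV hB hnd ((hρ.apply_mem_stab_iff φ Y t).2 (ht.mem_stab_of_le hB h))
    (hρ.finrank_ne hV hB hnd φ hne)

theorem IsInducedAction.smul_mem_flags (hV : Module.finrank K V = 4) (hB : B.IsAlt)
    (hnd : B.Nondegenerate) (hρ : IsInducedAction B ρ) (φ : MulAut (Sp B))
    {ω : Set (PointLine B)} (hω : ω ∈ flags B) : ρ φ • ω ∈ flags B := by
  obtain ⟨U, W, hU, hW, hlt, rfl⟩ := hω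
  have hne : Module.finrank K U.1 ≠ Module.finrank K W.1 := by omega
  have hne' := hρ.finrank_ne hV hB hnd φ hne
  have hs : ρ φ • ({U, W} : Set (PointLine B)) = {ρ φ U, ρ φ W} := Set.image_pair _ _ _
  rw [hs]
  have h1 := (ρ φ U).2.2
  have h2 := (ρ φ W).2.2
  rcases hρ.comparable hV hB hnd φ hlt.le hne with h | h
  · have := Submodule.finrank_mono h
    refine ⟨ρ φ U, ρ φ W, by omega, by omega, lt_of_le_of_ne h ?_, rfl⟩
    intro e
    exact hne' (by rw [e])
  · have := Submodule.finrank_mono h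
    refine ⟨ρ φ W, ρ φ U, by omega, by omega, lt_of_le_of_ne h ?_, Set.pair_comm _ _⟩
    intro e
    exact hne' (by rw [e])

end Action

/-! ### The exceptional duality in characteristic 2. -/

section Duality

/-- The Plücker coordinates of `x ∧ y` on the sides of the `4`-cycle of basis vectors, read as a
vector of `V`. -/
def pluecker (B : LinearMap.BilinForm K V) (v : Fin 4 → V) (x y : V) : V :=
  (B (v 2) x * B (v 3) y + B (v 3) x * B (v 2) y) • v 0 +
  (B (v 3) x * B (v 0) y + B (v 0) x * B (v 3) y) • v 1 +
  (B (v 0) x * B (v 1) y + B (v 1) x * B (v 0) y) • v 2 +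
  (B (v 1) x * B (v 2) y + B (v 2) x * B (v 1) y) • v 3

variable {v : Fin 4 → V}

theorem pluecker_comm (v : Fin 4 → V) (x y : V) : pluecker B v x y = pluecker B v y x := by
  simp only [pluecker]
  module

theorem IsCyclicBasis.form_pluecker (hv : IsCyclicBasis B v) (x y : V) (i : Fin 4) :
    B (v i) (pluecker B v x y) =
      B (v i) x * B (v (i + 1)) y + B (v (i + 1)) x * B (v i) y := by
  fin_cases i <;> simp [pluecker, hv _ _]

theorem IsCyclicBasis.ext (hv : IsCyclicBasis B v) (hV : Module.finrank K V = 4) {x y : V}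
    (h : ∀ i, B (v i) x = B (v i) y) : x = y := by
  rw [hv.expand hV x, hv.expand hV y, h, h, h, h]

theorem IsCyclicBasis.pluecker_succ (hv : IsCyclicBasis B v) (hV : Module.finrank K V = 4)
    (i : Fin 4) : pluecker B v (v i) (v (i + 1)) = v i := by
  refine hv.ext hV fun j => ?_
  rw [hv.form_pluecker, hv, hv, hv, hv]
  fin_cases i <;> fin_cases j <;> simp

theorem IsCyclicBasis.pluecker_mem (hv : IsCyclicBasis B v) (i : Fin 4) (z : V) :
    pluecker B v (v (i + 1)) z ∈ Submodule.span K {v i, v (i + 1)} := by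
  rw [Submodule.mem_span_pair]
  refine ⟨B (v (i + 2)) z, B (v i) z, ?_⟩
  fin_cases i <;> simp [pluecker, hv _ _, add_comm]

theorem IsCyclicBasis.form_succ (hv : IsCyclicBasis B v) (i : Fin 4) :
    B (v i) (v (i + 1)) = 0 := by
  rw [hv, if_neg (by revert i; decide)]

variable [CharP K 2]

/-- The right-hand side is the form induced on the exterior square. For an isotropic pair the two
Plücker coordinates on the diagonals of the `4`-cycle coincide, so in characteristic `2` their
contributions cancel and only the sides remain. -/
theorem IsCyclicBasis.form_pluecker_pluecker (hv : IsCyclicBasis B v)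
    (hV : Module.finrank K V = 4) {x y z w : V} (hxy : B x y = 0) (hzw : B z w = 0) :
    B (pluecker B v x y) (pluecker B v z w) = B x z * B y w + B x w * B y z := by
  rw [hv.form_eq hV] at hxy hzw ⊢
  rw [hv.form_eq hV x z, hv.form_eq hV y w, hv.form_eq hV x w, hv.form_eq hV y z]
  simp only [hv.form_pluecker, Fin.isValue, Fin.reduceAdd, zero_add]
  generalize B (v 0) x = x2, B (v 1) x = x3, B (v 2) x = x0, B (v 3) x = x1 at *
  generalize B (v 0) y = y2, B (v 1) y = y3, B (v 2) y = y0, B (v 3) y = y1 at *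
  generalize B (v 0) z = z2, B (v 1) z = z3, B (v 2) z = z0, B (v 3) z = z1 at *
  generalize B (v 0) w = w2, B (v 1) w = w3, B (v 2) w = w0, B (v 3) w = w1 at *
  grind

theorem IsCyclicBasis.pluecker_combination (hv : IsCyclicBasis B v)
    (hV : Module.finrank K V = 4) (p q r s : K) (x y : V) :
    pluecker B v (p • x + q • y) (r • x + s • y) = (p * s + q * r) • pluecker B v x y := by
  refine hv.ext hV fun i => ?_
  simp only [map_smul, hv.form_pluecker, map_add, smul_eq_mul]
  generalize B (v i) x = x0, B (v (i + 1)) x = x1, B (v i) y = y0, B (v (i + 1)) y = y1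
  linear_combination (p * r * x0 * x1 + q * s * y0 * y1) * CharTwo.two_eq_zero (R := K)

/-- The lines `xy` and `yz` meet in `y`: dualising twice returns `y`, up to a scalar, an index shift
and the Frobenius map on coordinates. -/
theorem IsCyclicBasis.form_pluecker_sq (hv : IsCyclicBasis B v) (hV : Module.finrank K V = 4)
    {x y z : V} (hxy : B x y = 0) (hyz : B y z = 0) (i : Fin 4) :
    B (v i) (pluecker B v (pluecker B v x y) (pluecker B v y z)) =
      B x z * B (v (i + 1)) y ^ 2 := by
  rw [hv.form_eq hV] at hxy hyz
  rw [hv.form_eq hV x z]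
  simp only [hv.form_pluecker]
  fin_cases i <;> simp only [Fin.zero_eta, Fin.mk_one, Fin.reduceFinMk, Fin.isValue, Fin.reduceAdd,
    zero_add] <;>
  · generalize B (v 0) x = x2, B (v 1) x = x3, B (v 2) x = x0, B (v 3) x = x1 at *
    generalize B (v 0) y = y2, B (v 1) y = y3, B (v 2) y = y0, B (v 3) y = y1 at *
    generalize B (v 0) z = z2, B (v 1) z = z3, B (v 2) z = z0, B (v 3) z = z1 at *
    grind

theorem IsCyclicBasis.pluecker_apply (hv : IsCyclicBasis B v) (hV : Module.finrank K V = 4)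
    (g : Sp B) :
    IsCyclicBasis B (fun i => pluecker B v (g.1 (v i)) (g.1 (v (i + 1)))) := by
  have h0 : ∀ i, B (g.1 (v i)) (g.1 (v (i + 1))) = 0 := fun i => by
    rw [g.2, hv, if_neg (by revert i; decide)]
  intro i j
  rw [hv.form_pluecker_pluecker hV (h0 i) (h0 j), g.2, g.2, g.2, g.2, hv, hv, hv, hv]
  fin_cases i <;> fin_cases j <;> simp

/-- The image of an isometry under the duality attached to a cyclic basis. -/
noncomputable def IsCyclicBasis.dualFun (hv : IsCyclicBasis B v) (hV : Module.finrank K V = 4)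
    (g : Sp B) : Sp B :=
  Classical.choose (hv.exists_isometry (hv.pluecker_apply hV g) hV)

theorem IsCyclicBasis.dualFun_apply (hv : IsCyclicBasis B v) (hV : Module.finrank K V = 4)
    (g : Sp B) (i : Fin 4) :
    (hv.dualFun hV g).1 (v i) = pluecker B v (g.1 (v i)) (g.1 (v (i + 1))) :=
  Classical.choose_spec (hv.exists_isometry (hv.pluecker_apply hV g) hV) i

/-- Both sides have the same products with the image basis, since the form on Plücker vectors
depends only on `B`. This is what makes the duality multiplicative. -/
theorem IsCyclicBasis.dualFun_pluecker (hv : IsCyclicBasis B v) (hV : Module.finrank K V = 4)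
    (g : Sp B) {x y : V} (hxy : B x y = 0) :
    (hv.dualFun hV g).1 (pluecker B v x y) = pluecker B v (g.1 x) (g.1 y) := by
  refine (hv.pluecker_apply hV g).ext hV fun i => ?_
  have h1 : B (g.1 (v i)) (g.1 (v (i + 1))) = 0 := (g.2 _ _).trans (hv.form_succ i)
  have h2 : B (g.1 x) (g.1 y) = 0 := (g.2 _ _).trans hxy
  rw [hv.form_pluecker_pluecker hV h1 h2, ← hv.dualFun_apply hV, (hv.dualFun hV g).2]
  conv_lhs => rw [← hv.pluecker_succ hV i]
  rw [hv.form_pluecker_pluecker hV (hv.form_succ i) hxy, g.2, g.2, g.2, g.2]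

/-- The exceptional endomorphism of `Sp(V)` in characteristic `2`: an isometry acts on the
totally isotropic lines through their Plücker coordinates, taken modulo the form. -/
noncomputable def IsCyclicBasis.dual (hv : IsCyclicBasis B v) (hV : Module.finrank K V = 4) :
    Sp B →* Sp B where
  toFun := hv.dualFun hV
  map_one' := hv.Sp_ext hV fun i => by
    rw [hv.dualFun_apply]
    exact hv.pluecker_succ hV i
  map_mul' g h := hv.Sp_ext hV fun i => by
    rw [hv.dualFun_apply]
    change _ = (hv.dualFun hV g).1 ((hv.dualFun hV h).1 (v i))
    rw [hv.dualFun_apply, hv.dualFun_pluecker hV g ((h.2 _ _).trans (hv.form_succ i))]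
    rfl

/-- By `form_pluecker_sq`, the dual of `g` determines the squares of the coordinates of each `g (v
i)`, and squaring is injective in characteristic `2`. -/
theorem IsCyclicBasis.dual_injective (hv : IsCyclicBasis B v) (hV : Module.finrank K V = 4) :
    Function.Injective (hv.dual hV) := by
  rw [injective_iff_map_eq_one]
  intro g hg
  have hT : ∀ i, pluecker B v (g.1 (v i)) (g.1 (v (i + 1))) = v i := fun i => by
    rw [← hv.dualFun_apply hV]
    exact congrArg (fun h : Sp B => h.1 (v i)) hg
  have key : ∀ (h : Sp B) (i j : Fin 4),
      B (v j) (pluecker B v (pluecker B v (h.1 (v i)) (h.1 (v (i + 1))))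
        (pluecker B v (h.1 (v (i + 1))) (h.1 (v (i + 1 + 1))))) = B (v (j + 1)) (h.1 (v (i + 1))) ^ 2 := by
    intro h i j
    rw [hv.form_pluecker_sq hV ((h.2 _ _).trans (hv.form_succ i))
      ((h.2 _ _).trans (hv.form_succ (i + 1))), h.2, hv, if_pos (by revert i; decide), one_mul]
  refine hv.Sp_ext hV fun i => hv.ext hV fun j => ?_
  obtain ⟨i, rfl⟩ : ∃ k, i = k + 1 := ⟨i - 1, by simp⟩
  obtain ⟨j, rfl⟩ : ∃ k, j = k + 1 := ⟨j - 1, by simp⟩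
  apply CharTwo.sq_injective
  simp only
  rw [← key, ← key, hT, hT]
  change _ = B (v j) (pluecker B v (pluecker B v (v i) (v (i + 1)))
    (pluecker B v (v (i + 1)) (v (i + 1 + 1))))
  rw [hv.pluecker_succ hV, hv.pluecker_succ hV, hv.pluecker_succ hV]

/-- The duality as an automorphism. -/
noncomputable def IsCyclicBasis.dualAut [Finite K] [FiniteDimensional K V] (hv : IsCyclicBasis B v)
    (hV : Module.finrank K V = 4) : MulAut (Sp B) :=
  MulEquiv.ofBijective (hv.dual hV) <| by
    have : Finite V := Module.finite_of_finite K
    have : Finite (Sp B) := Finite.of_injective (fun g : Sp B => (g.1 : V → V))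
      fun g h H => SymplecticFlags.Sp_ext fun x => congrFun H x
    exact Finite.injective_iff_bijective.1 (hv.dual_injective hV)

theorem IsCyclicBasis.dualAut_apply [Finite K] [FiniteDimensional K V] (hv : IsCyclicBasis B v)
    (hV : Module.finrank K V = 4) (g : Sp B) (i : Fin 4) :
    (hv.dualAut hV g).1 (v i) = pluecker B v (g.1 (v i)) (g.1 (v (i + 1))) :=
  hv.dualFun_apply hV g i

end Duality

/-! ### The dihedral group induced on an apartment. -/

section Octagon

variable {v : Fin 4 → V}

theorem IsCyclicBasis.pair (hv : IsCyclicBasis B v) (i : Fin 4) :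
    LinearIndependent K ![v i, v (i + 1)] := by
  have := hv.linearIndependent.comp ![i, i + 1] (by
    intro a b
    fin_cases a <;> fin_cases b <;> simp)
  have e : v ∘ ![i, i + 1] = ![v i, v (i + 1)] := by
    ext j; fin_cases j <;> rfl
  rwa [e] at this

variable [CharP K 2]

/-- The points of the apartment of a cyclic basis. -/
def IsCyclicBasis.pt (hv : IsCyclicBasis B v) (hB : B.IsAlt) (i : Fin 4) : PointLine B :=
  ⟨Submodule.span K {v i}, isTotallyIsotropic_span_singleton hB _,
    Or.inl (finrank_span_singleton (hv.ne_zero i))⟩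

/-- The lines of the apartment of a cyclic basis. -/
def IsCyclicBasis.ln (hv : IsCyclicBasis B v) (hB : B.IsAlt) (i : Fin 4) : PointLine B :=
  ⟨Submodule.span K {v i, v (i + 1)}, isTotallyIsotropic_span_pair hB (hv.form_succ i),
    Or.inr (finrank_span_pair_eq (hv.pair i))⟩

/-- The apartment of a cyclic basis, as a closed walk of length `8` in the incidence graph. -/
def IsCyclicBasis.apartment (hv : IsCyclicBasis B v) (hB : B.IsAlt) : Fin 8 → PointLine B :=
  ![hv.pt hB 0, hv.ln hB 0, hv.pt hB 1, hv.ln hB 1, hv.pt hB 2, hv.ln hB 2, hv.pt hB 3, hv.ln hB 3]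

variable [Finite K] [FiniteDimensional K V] {ρ : MulAut (Sp B) →* Equiv.Perm (PointLine B)}

theorem IsCyclicBasis.dualAut_mem_stab_pt (hv : IsCyclicBasis B v) (hV : Module.finrank K V = 4)
    (hB : B.IsAlt) {i : Fin 4} {g : Sp B} (hg : g ∈ stab B (hv.ln hB i).1) :
    hv.dualAut hV g ∈ stab B (hv.pt hB i).1 := by
  refine mem_stab fun x hx => ?_
  obtain ⟨c, rfl⟩ := Submodule.mem_span_singleton.1 hx
  obtain ⟨p, q, hpq⟩ := Submodule.mem_span_pair.1
    (apply_mem_of_mem_stab hg (x := v i) (Submodule.subset_span (by simp)))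
  obtain ⟨r, s, hrs⟩ := Submodule.mem_span_pair.1
    (apply_mem_of_mem_stab hg (x := v (i + 1)) (Submodule.subset_span (by simp)))
  rw [map_smul, hv.dualAut_apply hV, ← hpq, ← hrs, hv.pluecker_combination hV, hv.pluecker_succ hV]
  exact Submodule.smul_mem _ _ (Submodule.smul_mem _ _ (Submodule.mem_span_singleton_self _))

theorem IsCyclicBasis.dualAut_mem_stab_ln (hv : IsCyclicBasis B v) (hV : Module.finrank K V = 4)
    (hB : B.IsAlt) {i : Fin 4} {g : Sp B} (hg : g ∈ stab B (hv.pt hB (i + 1)).1) :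
    hv.dualAut hV g ∈ stab B (hv.ln hB i).1 := by
  obtain ⟨c, hc⟩ := Submodule.mem_span_singleton.1
    (apply_mem_of_mem_stab hg (x := v (i + 1)) (Submodule.mem_span_singleton_self _))
  have hsmul : ∀ z, pluecker B v (c • v (i + 1)) z ∈ Submodule.span K {v i, v (i + 1)} := fun z => by
    -- A scalar on one argument of `pluecker` comes out as a diagonal determinant.
    have := hv.pluecker_combination hV c 0 0 1 (v (i + 1)) z
    simp only [zero_smul, add_zero, one_smul, zero_add, mul_one, mul_zero] at this
    rw [this]
    exact Submodule.smul_mem _ _ (hv.pluecker_mem i z)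
  refine mem_stab fun x hx => ?_
  obtain ⟨p, q, rfl⟩ := Submodule.mem_span_pair.1 hx
  rw [map_add, map_smul, map_smul, hv.dualAut_apply hV, hv.dualAut_apply hV, ← hc,
    pluecker_comm v (g.1 (v i))]
  exact add_mem (Submodule.smul_mem _ _ (hsmul _)) (Submodule.smul_mem _ _ (hsmul _))

theorem IsCyclicBasis.dualAut_pt (hv : IsCyclicBasis B v) (hV : Module.finrank K V = 4)
    (hB : B.IsAlt) (hnd : B.Nondegenerate) (hρ : IsInducedAction B ρ) (i : Fin 4) :
    ρ (hv.dualAut hV) (hv.pt hB (i + 1)) = hv.ln hB i := by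
  have hle : stab B (ρ (hv.dualAut hV) (hv.pt hB (i + 1))).1 ≤ stab B (hv.ln hB i).1 := by
    rw [hρ]
    rintro _ ⟨g, hg, rfl⟩
    exact hv.dualAut_mem_stab_ln hV hB hg
  have h := stab_le_stab hB hnd (hv.ln hB i).2.1 hle
  have h2 : Module.finrank K (hv.ln hB i).1 = 2 := finrank_span_pair_eq (hv.pair i)
  refine Subtype.ext (Submodule.eq_of_le_of_finrank_eq h ?_).symm
  have := Submodule.finrank_mono h
  have := (ρ (hv.dualAut hV) (hv.pt hB (i + 1))).2.2
  omega

theorem IsCyclicBasis.dualAut_ln (hv : IsCyclicBasis B v) (hV : Module.finrank K V = 4)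
    (hB : B.IsAlt) (hnd : B.Nondegenerate) (hρ : IsInducedAction B ρ) (i : Fin 4) :
    ρ (hv.dualAut hV) (hv.ln hB i) = hv.pt hB i := by
  have hle : stab B (ρ (hv.dualAut hV) (hv.ln hB i)).1 ≤ stab B (hv.pt hB i).1 := by
    rw [hρ]
    rintro _ ⟨g, hg, rfl⟩
    exact hv.dualAut_mem_stab_pt hV hB hg
  have h := stab_le_stab hB hnd (hv.pt hB i).2.1 hle
  have h1 : ∀ j, Module.finrank K (hv.pt hB j).1 = 1 := fun j =>
    finrank_span_singleton (hv.ne_zero j)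
  have h2 : ∀ j, Module.finrank K (hv.ln hB j).1 = 2 := fun j => finrank_span_pair_eq (hv.pair j)
  -- A point goes to a line under the duality, so a line cannot go to a line.
  have hne := hρ.finrank_ne hV hB hnd (hv.dualAut hV) (X := hv.pt hB (0 + 1)) (Y := hv.ln hB i)
    (by rw [h1, h2]; decide)
  rw [hv.dualAut_pt hV hB hnd hρ, h2] at hne
  refine Subtype.ext (Submodule.eq_of_le_of_finrank_eq h ?_).symm
  have := (ρ (hv.dualAut hV) (hv.ln hB i)).2.2
  rw [h1]
  omega

theorem IsCyclicBasis.dualAut_apartment (hv : IsCyclicBasis B v) (hV : Module.finrank K V = 4)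
    (hB : B.IsAlt) (hnd : B.Nondegenerate) (hρ : IsInducedAction B ρ) (k : Fin 8) :
    ρ (hv.dualAut hV) (hv.apartment hB k) = hv.apartment hB (k - 1) := by
  fin_cases k
  · exact hv.dualAut_pt hV hB hnd hρ 3
  · exact hv.dualAut_ln hV hB hnd hρ 0
  · exact hv.dualAut_pt hV hB hnd hρ 0
  · exact hv.dualAut_ln hV hB hnd hρ 1
  · exact hv.dualAut_pt hV hB hnd hρ 1
  · exact hv.dualAut_ln hV hB hnd hρ 2
  · exact hv.dualAut_pt hV hB hnd hρ 2
  · exact hv.dualAut_ln hV hB hnd hρ 3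

omit [Finite K] in
theorem IsCyclicBasis.exists_neg_apartment (hv : IsCyclicBasis B v) (hV : Module.finrank K V = 4)
    (hB : B.IsAlt) (hnd : B.Nondegenerate) (hρ : IsInducedAction B ρ) :
    ∃ φ : MulAut (Sp B), ∀ k, ρ φ (hv.apartment hB k) = hv.apartment hB (-k) := by
  have hw : IsCyclicBasis B (v ∘ fun i => -i) := hv.comp (by decide)
  obtain ⟨g, hg⟩ := hv.exists_isometry hw hV
  have hg : ∀ i, g.1 (v i) = v (-i) := hg
  have hpt : ∀ i, ρ (MulAut.conj g) (hv.pt hB i) = hv.pt hB (-i) := fun i => Subtype.ext <| by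
    rw [hρ.conj_apply hB hnd]
    simp only [IsCyclicBasis.pt, Submodule.map_span, Set.image_singleton, LinearEquiv.coe_coe, hg]
  have hln : ∀ i j, i + j + 1 = 0 → ρ (MulAut.conj g) (hv.ln hB i) = hv.ln hB j :=
    fun i j hij => Subtype.ext <| by
    rw [hρ.conj_apply hB hnd]
    have h1 : -(i + 1) = j := by rw [neg_eq_iff_add_eq_zero, add_right_comm, hij]
    have h2 : -i = j + 1 := by rw [neg_eq_iff_add_eq_zero, ← add_assoc, hij]
    simp only [IsCyclicBasis.ln, Submodule.map_span, Set.image_pair, LinearEquiv.coe_coe, hg, h1, h2]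
    rw [Set.pair_comm]
  refine ⟨MulAut.conj g, fun k => ?_⟩
  fin_cases k
  · exact hpt 0
  · exact hln 0 3 rfl
  · exact hpt 1
  · exact hln 1 2 rfl
  · exact hpt 2
  · exact hln 2 1 rfl
  · exact hpt 3
  · exact hln 3 0 rfl

/-- Every reflection of an apartment is induced by an automorphism of `Sp(V)`. -/
theorem IsCyclicBasis.exists_reflection (hv : IsCyclicBasis B v) (hV : Module.finrank K V = 4)
    (hB : B.IsAlt) (hnd : B.Nondegenerate) (hρ : IsInducedAction B ρ) (m : Fin 8) :
    ∃ φ : MulAut (Sp B), ∀ k, ρ φ (hv.apartment hB k) = hv.apartment hB (m - k) := by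
  obtain ⟨σ, hσ⟩ := hv.exists_neg_apartment hV hB hnd hρ
  have hpow : ∀ (n : ℕ) (k : Fin 8), ρ (hv.dualAut hV ^ n) (hv.apartment hB k) =
      hv.apartment hB (k - n • (1 : Fin 8)) := by
    intro n
    induction n with
    | zero => intro k; simp
    | succ n ih =>
      intro k
      rw [pow_succ, map_mul, Equiv.Perm.mul_apply, hv.dualAut_apartment hV hB hnd hρ, ih]
      congr 1
      rw [succ_nsmul]
      abel
  -- The duality lowers indices by one, so `-m` applications add `m`.
  refine ⟨hv.dualAut hV ^ (-m).val * σ, fun k => ?_⟩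
  rw [map_mul, Equiv.Perm.mul_apply, hσ, hpow]
  congr 1
  have h : ∀ l : Fin 8, l.val • (1 : Fin 8) = l := by decide
  rw [h]
  abel

theorem IsCyclicBasis.exists_swap (hv : IsCyclicBasis B v) (hV : Module.finrank K V = 4)
    (hB : B.IsAlt) (hnd : B.Nondegenerate) (hρ : IsInducedAction B ρ) (i j : Fin 8) :
    ∃ φ : MulAut (Sp B),
      ρ φ • ({hv.apartment hB i, hv.apartment hB (i + 1)} : Set (PointLine B)) =
        {hv.apartment hB j, hv.apartment hB (j + 1)} ∧
      ρ φ • ({hv.apartment hB j, hv.apartment hB (j + 1)} : Set (PointLine B)) =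
        {hv.apartment hB i, hv.apartment hB (i + 1)} := by
  -- The reflection `k ↦ i + j + 1 - k` exchanges `i` with `j + 1` and `i + 1` with `j`.
  obtain ⟨φ, hφ⟩ := hv.exists_reflection hV hB hnd hρ (i + j + 1)
  have key : ∀ i' j', i' + j' = i + j →
      ρ φ • ({hv.apartment hB i', hv.apartment hB (i' + 1)} : Set (PointLine B)) =
        {hv.apartment hB j', hv.apartment hB (j' + 1)} := by
    intro i' j' h
    refine (Set.image_pair _ _ _).trans ?_
    have h1 : i + j + 1 - i' = j' + 1 := by rw [← h]; abel
    have h2 : i + j + 1 - (i' + 1) = j' := by rw [← h]; abel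
    simp only [Equiv.Perm.smul_def, hφ, h1, h2]
    rw [Set.pair_comm]
  exact ⟨φ, key i j rfl, key j i (add_comm _ _)⟩

end Octagon

/-! ### Two incident pairs in one apartment. -/

section CommonApartment

theorem exists_ne_zero_form_eq_zero {W : Submodule K V} (hW : Module.finrank K W = 2) (u : V) :
    ∃ x ∈ W, x ≠ 0 ∧ B u x = 0 := by
  obtain ⟨a, b, hab, rfl⟩ := exists_pair_of_finrank_eq_two hW
  have ha : a ∈ Submodule.span K {a, b} := Submodule.subset_span (by simp)
  have hb : b ∈ Submodule.span K {a, b} := Submodule.subset_span (by simp)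
  by_cases h : B u a = 0
  · exact ⟨a, ha, hab.ne_zero 0, h⟩
  · refine ⟨B u b • a - B u a • b, sub_mem (Submodule.smul_mem _ _ ha) (Submodule.smul_mem _ _ hb),
      fun h0 => h ?_, by simp [mul_comm]⟩
    rw [sub_eq_add_neg, ← neg_smul] at h0
    exact neg_eq_zero.1 (LinearIndependent.pair_iff.1 hab _ _ h0).2

theorem exists_smul_form_eq_one {W : Submodule K V} {a y : V} (hy : y ∈ W) (h : B a y ≠ 0) :
    ∃ z ∈ W, B a z = 1 :=
  ⟨(B a y)⁻¹ • y, W.smul_mem _ hy, by rw [map_smul, smul_eq_mul, inv_mul_cancel₀ h]⟩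

theorem exists_form_eq_one_of_notMem [FiniteDimensional K V] (hV : Module.finrank K V = 4)
    (hB : B.IsAlt) (hnd : B.Nondegenerate) {W : Submodule K V} (hiso : IsTotallyIsotropic B W)
    (hW : Module.finrank K W = 2) {a : V} (ha : a ∉ W) : ∃ y ∈ W, B a y = 1 := by
  obtain ⟨y, hy, h⟩ := exists_perp_not_perp hB hnd ha
  rw [hiso.orthogonal_eq hV hnd hW] at hy
  refine exists_smul_form_eq_one hy ?_
  rwa [← hB.neg_eq, neg_ne_zero]

variable [CharP K 2] {v : Fin 4 → V}

theorem IsCyclicBasis.flag_eq_edge (hv : IsCyclicBasis B v) (hB : B.IsAlt) {U W : PointLine B}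
    (hU : Module.finrank K U.1 = 1) (hW : Module.finrank K W.1 = 2) (hUW : U.1 < W.1) {i k : Fin 4}
    (hik : k = i + 1 ∨ i = k + 1) (hi : v i ∈ U.1) (hk : v k ∈ W.1) :
    ∃ m : Fin 8, ({U, W} : Set (PointLine B)) = {hv.apartment hB m, hv.apartment hB (m + 1)} := by
  have hfU : FiniteDimensional K U.1 := Module.finite_of_finrank_eq_succ hU
  have hfW : FiniteDimensional K W.1 := Module.finite_of_finrank_eq_succ hW
  have hpt : U = hv.pt hB i := Subtype.ext <| by
    refine (Submodule.eq_of_le_of_finrank_eq ?_ ?_).symm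
    · exact (Submodule.span_singleton_le_iff_mem _ _).2 hi
    · rw [hU]; exact finrank_span_singleton (hv.ne_zero i)
  have hi' := hUW.le hi
  have hln : ∀ j, v j ∈ W.1 → v (j + 1) ∈ W.1 → W = hv.ln hB j := fun j h1 h2 => Subtype.ext <| by
    refine (Submodule.eq_of_le_of_finrank_eq ?_ ?_).symm
    · refine Submodule.span_le.2 ?_
      rintro x (rfl | rfl)
      · exact h1
      · exact h2
    · rw [hW]; exact finrank_span_pair_eq (hv.pair j)
  rcases hik with rfl | rfl
  · rw [hpt, hln i hi' hk]
    fin_cases i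
    exacts [⟨0, rfl⟩, ⟨2, rfl⟩, ⟨4, rfl⟩, ⟨6, rfl⟩]
  · rw [hpt, hln k hk hi', Set.pair_comm]
    fin_cases k
    exacts [⟨1, rfl⟩, ⟨3, rfl⟩, ⟨5, rfl⟩, ⟨7, rfl⟩]

/-- The cases are the relative positions of the two flags. In each, vectors chosen in the four
subspaces form part of a cyclic basis, which `exists_fourth` or `exists_isCyclicBasis` completes
where necessary. -/
theorem exists_adapted_basis [FiniteDimensional K V] (hV : Module.finrank K V = 4)
    (hB : B.IsAlt) (hnd : B.Nondegenerate) {U W U' W' : PointLine B}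
    (hU : Module.finrank K U.1 = 1) (hW : Module.finrank K W.1 = 2) (hUW : U.1 < W.1)
    (hU' : Module.finrank K U'.1 = 1) (hW' : Module.finrank K W'.1 = 2) (hUW' : U'.1 < W'.1) :
    ∃ v, IsCyclicBasis B v ∧ ∃ i k i' k' : Fin 4, (k = i + 1 ∨ i = k + 1) ∧
      (k' = i' + 1 ∨ i' = k' + 1) ∧ v i ∈ U.1 ∧ v k ∈ W.1 ∧ v i' ∈ U'.1 ∧ v k' ∈ W'.1 := by
  obtain ⟨a, ha0, hUa⟩ := exists_of_finrank_eq_one hU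
  obtain ⟨a', ha0', hUa'⟩ := exists_of_finrank_eq_one hU'
  have ha : a ∈ U.1 := hUa ▸ Submodule.mem_span_singleton_self a
  have ha' : a' ∈ U'.1 := hUa' ▸ Submodule.mem_span_singleton_self a'
  have haW := hUW.le ha
  have haW' := hUW'.le ha'
  by_cases haa : B a a' = 0
  · by_cases hmem : a ∈ U'.1
    · have hli : ∀ x ∉ U.1, LinearIndependent K ![a, x] := fun x hx => by
        rw [LinearIndependent.pair_iff' ha0]
        rintro c rfl
        exact hx (Submodule.smul_mem _ _ ha)
      by_cases hWW : W.1 = W'.1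
      · obtain ⟨x, hx, hxU⟩ := SetLike.exists_of_lt hUW
        obtain ⟨v, hv, rfl, rfl⟩ := exists_isCyclicBasis hB hnd (hli x hxU) (W.2.1 _ haW _ hx)
        exact ⟨v, hv, 0, 1, 0, 1, by decide, by decide, ha, hx, hmem, hWW ▸ hx⟩
      · have h : ¬ W.1 ≤ W'.1 := fun h => hWW (Submodule.eq_of_le_of_finrank_eq h (by rw [hW, hW']))
        obtain ⟨x, hx, hx'⟩ := SetLike.not_le_iff_exists.1 h
        obtain ⟨y, hy, hxy⟩ := exists_form_eq_one_of_notMem hV hB hnd W'.2.1 hW' hx'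
        have hxa := W.2.1 x hx a haW
        have hay := W'.2.1 a (hUW'.le hmem) y hy
        obtain ⟨d, h1, h2, h3⟩ := exists_fourth hB hnd ha0 hxa hxy hay
        exact ⟨_, isCyclicBasis_of hB hxa hxy h1 hay h2 h3, 1, 0, 1, 2, by decide, by decide,
          ha, hx, hmem, hy⟩
    · by_cases h1 : a' ∈ W.1 <;> by_cases h2 : a ∈ W'.1
      · have hli : LinearIndependent K ![a, a'] := by
          rw [LinearIndependent.pair_symm_iff, LinearIndependent.pair_iff' ha0']
          rintro c rfl
          exact hmem (Submodule.smul_mem _ _ ha')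
        obtain ⟨v, hv, rfl, rfl⟩ := exists_isCyclicBasis hB hnd hli haa
        exact ⟨v, hv, 0, 1, 1, 0, by decide, by decide, ha, h1, ha', h2⟩
      · obtain ⟨y, hy, hay⟩ := exists_form_eq_one_of_notMem hV hB hnd W'.2.1 hW' h2
        have hy' := W'.2.1 a' haW' y hy
        obtain ⟨d, e1, e2, e3⟩ := exists_fourth hB hnd ha0' haa hay hy'
        exact ⟨_, isCyclicBasis_of hB haa hay e1 hy' e2 e3, 0, 1, 1, 2, by decide, by decide,
          ha, h1, ha', hy⟩
      · obtain ⟨x, hx, hax⟩ := exists_form_eq_one_of_notMem hV hB hnd W.2.1 hW h1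
        have hx' := W.2.1 a haW x hx
        have haa' : B a' a = 0 := by rw [alt_comm hB, haa]
        obtain ⟨d, e1, e2, e3⟩ := exists_fourth hB hnd ha0 haa' hax hx'
        exact ⟨_, isCyclicBasis_of hB haa' hax e1 hx' e2 e3, 1, 2, 0, 1, by decide, by decide,
          ha, hx, ha', h2⟩
      · obtain ⟨y, hy, hay⟩ := exists_form_eq_one_of_notMem hV hB hnd W'.2.1 hW' h2
        obtain ⟨x, hx, hax⟩ := exists_form_eq_one_of_notMem hV hB hnd W.2.1 hW h1
        have hx' := W.2.1 a haW x hx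
        have hy' := W'.2.1 a' haW' y hy
        -- The line joining the two points is neither `W` nor `W'`; adding a multiple of `a` keeps
        -- the vector in `W` and makes it orthogonal to `y`.
        refine ⟨_, isCyclicBasis_of hB (d := x + B y x • a) haa hay ?_ hy' ?_ ?_, 0, 3, 1, 2,
          by decide, by decide, ha, add_mem hx (Submodule.smul_mem _ _ haW), ha', hy⟩
        · simp [hx', hB.self_eq_zero]
        · simp [hax, alt_comm hB a' a, haa]
        · simp [alt_comm hB y a, hay, CharTwo.add_self_eq_zero]
  · obtain ⟨c, hc, hac⟩ := exists_smul_form_eq_one ha' haa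
    have hcW := hUW'.le hc
    -- The points are not collinear, so each line is projected onto the perp of the opposite point.
    -- The resulting `x` and `y` are proportional if orthogonal, and otherwise form a second
    -- hyperbolic pair.
    obtain ⟨x, hx, hx0, hcx⟩ := exists_ne_zero_form_eq_zero (B := B) hW c
    obtain ⟨y, hy, hy0, hay⟩ := exists_ne_zero_form_eq_zero (B := B) hW' a
    have hax := W.2.1 a haW x hx
    have hcy := W'.2.1 c hcW y hy
    have hxc : B x c = 0 := by rw [alt_comm hB, hcx]
    by_cases hxy : B x y = 0
    · obtain ⟨d, e1, e2, e3⟩ := exists_fourth hB hnd hx0 hax hac hxc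
      have hv := isCyclicBasis_of hB hax hac e1 hxc e2 e3
      have h : y = B d y • x := by simpa [hcy, hay, hxy] using hv.expand hV y
      have hd : B d y ≠ 0 := fun h0 => hy0 (by rw [h, h0, zero_smul])
      rw [h, Submodule.smul_mem_iff _ hd] at hy
      exact ⟨_, hv, 0, 1, 2, 1, by decide, by decide, ha, hx, hc, hy⟩
    · have hk : B x ((B x y)⁻¹ • y) = 1 := by
        rw [map_smul, smul_eq_mul, inv_mul_cancel₀ hxy]
      exact ⟨_, isCyclicBasis_of hB (d := (B x y)⁻¹ • y) hax hac (by rw [map_smul, hay, smul_zero])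
        hxc hk (by rw [map_smul, hcy, smul_zero]), 0, 1, 2, 3, by decide, by decide, ha, hx, hc,
        Submodule.smul_mem _ _ hy⟩

/-- Any two incident pairs lie in a common apartment. -/
theorem exists_common_apartment [FiniteDimensional K V] (hV : Module.finrank K V = 4)
    (hB : B.IsAlt) (hnd : B.Nondegenerate) {ω₁ ω₂ : Set (PointLine B)} (h₁ : ω₁ ∈ flags B)
    (h₂ : ω₂ ∈ flags B) : ∃ (v : Fin 4 → V) (hv : IsCyclicBasis B v) (i j : Fin 8),
      ω₁ = {hv.apartment hB i, hv.apartment hB (i + 1)} ∧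
      ω₂ = {hv.apartment hB j, hv.apartment hB (j + 1)} := by
  obtain ⟨U, W, hU, hW, hUW, rfl⟩ := h₁
  obtain ⟨U', W', hU', hW', hUW', rfl⟩ := h₂
  obtain ⟨v, hv, i, k, i', k', hik, hik', hi, hk, hi', hk'⟩ :=
    exists_adapted_basis hV hB hnd hU hW hUW hU' hW' hUW'
  obtain ⟨m, hm⟩ := hv.flag_eq_edge hB hU hW hUW hik hi hk
  obtain ⟨m', hm'⟩ := hv.flag_eq_edge hB hU' hW' hUW' hik' hi' hk'
  exact ⟨v, hv, m, m', hm, hm'⟩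

end CommonApartment

/-! ### Passage to digraphs. -/

/-- If any two elements of `Ω` are interchanged by `G`, then the stabiliser of an element of `Ω`
is not a vertex stabiliser of an arc-bearing digraph on which `G` acts vertex-transitively. -/
theorem stabilizer_ne_of_swap {G X S : Type*} [Group G] [MulAction G X]
    [MulAction.IsPretransitive G X] (ρ : G →* Equiv.Perm S) {Ω : Set (Set S)}
    (hΩ : ∀ g, ∀ ω ∈ Ω, ρ g • ω ∈ Ω)
    (hswap : ∀ ω₁ ∈ Ω, ∀ ω₂ ∈ Ω, ∃ g, ρ g • ω₁ = ω₂ ∧ ρ g • ω₂ = ω₁) (Γ : Digraph X)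
    (hanti : ∀ u v, Γ.Adj u v → ¬ Γ.Adj v u)
    (hinv : ∀ (g : G) (u v : X), Γ.Adj u v → Γ.Adj (g • u) (g • v)) (harc : ∃ u v, Γ.Adj u v)
    (v : X) {ω : Set S} (hω : ω ∈ Ω) :
    MulAction.stabilizer G v ≠ (MulAction.stabilizer (Equiv.Perm S) ω).comap ρ := by
  intro heq
  have hmem : ∀ g, g • v = v ↔ ρ g • ω = ω := fun g => by
    rw [← MulAction.mem_stabilizer_iff, heq, Subgroup.mem_comap, MulAction.mem_stabilizer_iff]
  obtain ⟨u, w, huw⟩ := harc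
  obtain ⟨h, rfl⟩ := MulAction.exists_smul_eq G u v
  obtain ⟨k, hk⟩ := MulAction.exists_smul_eq G (h • u) (h • w)
  have hadj := hinv h u w huw
  -- Equal stabilisers make `g • v ↦ ρ g • ω` well defined and injective, so swapping `ω` with `ρ k
  -- • ω` swaps the two ends of the arc.
  obtain ⟨g, hg1, hg2⟩ := hswap ω hω (ρ k • ω) (hΩ k ω hω)
  have e1 : g • (h • u) = h • w := by
    have := (hmem (k⁻¹ * g)).2 (by rw [map_mul, mul_smul, hg1, ← mul_smul, ← map_mul,
      inv_mul_cancel, map_one, one_smul])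
    rw [mul_smul, inv_smul_eq_iff] at this
    rw [this, hk]
  have e2 : g • (h • w) = h • u := by
    have := (hmem (g * k)).2 (by rw [map_mul, mul_smul, hg2])
    rwa [mul_smul, hk] at this
  have := hinv g _ _ hadj
  rw [e1, e2] at this
  exact hanti _ _ hadj this

end SymplecticFlags

theorem lemma4p22 {K V : Type*} [Field K] [Finite K] [CharP K 2] [AddCommGroup V] [Module K V]
    (hV : Module.finrank K V = 4) (B : LinearMap.BilinForm K V) (hB : B.IsAlt)
    (hnd : B.Nondegenerate) :
    ∃ ρ : MulAut (SymplecticFlags.Sp B) →* Equiv.Perm (SymplecticFlags.PointLine B),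
      -- `ρ` is the induced action, and it is the only one
      SymplecticFlags.IsInducedAction B ρ ∧
      (∀ ρ', SymplecticFlags.IsInducedAction B ρ' → ρ' = ρ) ∧
      -- it acts on the set of incident pairs
      (∀ φ, ∀ ω ∈ SymplecticFlags.flags B, ρ φ • ω ∈ SymplecticFlags.flags B) ∧
      -- any two incident pairs are interchanged by some element
      (∀ ω₁ ∈ SymplecticFlags.flags B, ∀ ω₂ ∈ SymplecticFlags.flags B,
        ∃ g : MulAut (SymplecticFlags.Sp B), ρ g • ω₁ = ω₂ ∧ ρ g • ω₂ = ω₁) ∧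
      -- the stabiliser of an incident pair is not a vertex stabiliser of a digraph
      (∀ (X : Type*) [MulAction (MulAut (SymplecticFlags.Sp B)) X]
        [MulAction.IsPretransitive (MulAut (SymplecticFlags.Sp B)) X] (Γ : Digraph X),
        (∀ u v, Γ.Adj u v → ¬ Γ.Adj v u) →
        (∀ (g : MulAut (SymplecticFlags.Sp B)) (u v : X), Γ.Adj u v → Γ.Adj (g • u) (g • v)) →
        (∃ u v, Γ.Adj u v) →
        ∀ v : X, ∀ ω ∈ SymplecticFlags.flags B,
          MulAction.stabilizer (MulAut (SymplecticFlags.Sp B)) v ≠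
            SymplecticFlags.setStabiliser B ρ ω) := by
  have hfin : FiniteDimensional K V := Module.finite_of_finrank_eq_succ hV
  obtain ⟨ρ, hρ⟩ := SymplecticFlags.exists_isInducedAction hV hB hnd
  have hflags : ∀ φ, ∀ ω ∈ SymplecticFlags.flags B, ρ φ • ω ∈ SymplecticFlags.flags B :=
    fun φ ω hω => hρ.smul_mem_flags hV hB hnd φ hω
  have hswap : ∀ ω₁ ∈ SymplecticFlags.flags B, ∀ ω₂ ∈ SymplecticFlags.flags B,
      ∃ g : MulAut (SymplecticFlags.Sp B), ρ g • ω₁ = ω₂ ∧ ρ g • ω₂ = ω₁ := by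
    intro ω₁ h₁ ω₂ h₂
    obtain ⟨v, hv, i, j, rfl, rfl⟩ := SymplecticFlags.exists_common_apartment hV hB hnd h₁ h₂
    exact hv.exists_swap hV hB hnd hρ i j
  refine ⟨ρ, hρ, fun ρ' hρ' => hρ.unique hB hnd hρ', hflags, hswap, ?_⟩
  intro X _ _ Γ hanti hinv harc v ω hω
  exact SymplecticFlags.stabilizer_ne_of_swap ρ hflags hswap Γ hanti hinv harc v hω
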